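/- Let $1\le q<p<\infty$, $p'=p/(p-1)$ and $0<\theta<\pi/2$. Let $(\lambda_k)$ be complex numbers with $\operatorname{Re}\lambda_k<0$ and $|\arg(-\lambda_k)|<\theta$ for all $k$, let $A$ be the diagonal operator on $\ell^q$ with $Ae_k=\lambda_k e_k$ (on its maximal domain), and let $(T(t))_{t\ge0}$, $T(t)e_k=e^{\lambda_k t}e_k$, be the semigroup it generates. Let $D(A^*)'$ be the completion of $\ell^q$ in the norm $\|(1-A)^{-1}x\|_{\ell^q}$, that is, the space of all sequences $(x_k)$ with $(x_k/(1-\lambda_k))\in\ell^q$; $T(t)$ extends to $D(A^*)'$, and $(s-A)^{-1}$, for $s>0$, extends to a bounded operator from $D(A^*)'$ to $\ell^q$. Let $B:\mathbb C\to D(A^*)'$ be linear and bounded, given by the sequence $(b_k)$, and put $\mu=\sum_k|b_k|^q\delta_{-\lambda_k}$ and $S_n=\{z\in\mathbb C: 2^{n-1}<\operatorname{Re}z\le 2^n\}$. Then the following statements are equivalent. 1. $B$ is an admissible control operator with respect to $L^p(0,\infty)$: there is $m_0>0$ such that for every $u\in L^p(0,\infty)$ the integral $\int_0^\infty T(t)Bu(t)\,dt=\lim_{\tau\to\infty}\int_0^\tau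 T(t)Bu(t)\,dt$ (limit in $D(A^*)'$) exists, belongs to $\ell^q$, and satisfies $\left\|\int_0^\infty T(t)Bu(t)\,dt\right\|_{\ell^q}\le m_0\|u\|_{L^p(0,\infty)}$. 2. The sequence $(2^{-nq/p'}\mu(S_n))_{n\in\mathbb Z}$ is in $\ell^{p/(p-q)}(\mathbb Z)$. 3. The sequence $(2^{n/p}\|(2^n-A)^{-1}B\|_{\ell^q})_{n\in\mathbb Z}$ is in $\ell^{qp/(p-q)}(\mathbb Z)$. If $q<p'$, then these are also equivalent to 4. The function $t\mapsto|t|^{q(2-p)/p}S_\mu(t)$ is in $L^{p/(p-q)}(\mathbb R)$, where $S_\mu(t)=\int_{\mathbb C_+}\frac1\pi\,\frac{x}{x^2+(t-y)^2}\,d\mu(x+iy)$ is the balayage of $\mu$ onto the boundary of the right half-plane $\mathbb C_+$. -/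

import Mathlib

open MeasureTheory Filter Topology
open scoped ENNReal NNReal

noncomputable section

namespace DiagSystem

instance factOneLeOfReal {q : ℝ} [hq : Fact (1 ≤ q)] : Fact (1 ≤ ENNReal.ofReal q) :=
  ⟨by simpa using ENNReal.ofReal_le_ofReal hq.out⟩

/-- The complex sequence space `ℓ^q`, for a real exponent `q`. -/
abbrev Ellq (q : ℝ) : Type := lp (fun _ : ℕ => ℂ) (ENNReal.ofReal q)

/-- The open left half-plane. -/
abbrev LeftHP : Type := {z : ℂ // z.re < 0}

theorem sub_ne_zero_of_pos (l : LeftHP) {s : ℝ} (hs : 0 < s) : (s : ℂ) - l ≠ 0 := by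
  intro h
  have h1 := congrArg Complex.re h
  have h2 := l.2
  simp at h1
  linarith

theorem one_sub_ne_zero (l : LeftHP) : (1 : ℂ) - l ≠ 0 := by
  simpa using sub_ne_zero_of_pos l one_pos

theorem memlp_mul {q : ℝ} {m x : ℕ → ℂ} (C : ℝ) (hm : ∀ k, ‖m k‖ ≤ C)
    (hx : Memℓp x (ENNReal.ofReal q)) : Memℓp (fun k => m k * x k) (ENNReal.ofReal q) := by
  refine (hx.const_mul (C : ℂ)).mono' fun k => ?_
  rw [norm_mul, norm_mul]
  refine mul_le_mul_of_nonneg_right ((hm k).trans ?_) (norm_nonneg _)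
  simpa using le_abs_self C

/-- Multiplication by a bounded sequence, as a bounded operator on `ℓ^q`. -/
def mulCLM {q : ℝ} [Fact (1 ≤ q)] (m : ℕ → ℂ) (C : ℝ) (hm : ∀ k, ‖m k‖ ≤ C) :
    Ellq q →L[ℂ] Ellq q :=
  LinearMap.mkContinuous
    { toFun := fun x => ⟨fun k => m k * x k, memlp_mul C hm (lp.memℓp x)⟩
      map_add' := fun x y => by
        apply lp.ext; funext k
        exact mul_add (m k) (x k) (y k)
      map_smul' := fun c x => by
        apply lp.ext; funext k
        exact mul_left_comm (m k) c (x k) }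
    C (fun x => by
      have hC : 0 ≤ C := (norm_nonneg _).trans (hm 0)
      have h0 : ENNReal.ofReal q ≠ 0 :=
        (lt_of_lt_of_le one_pos (Fact.out : 1 ≤ ENNReal.ofReal q)).ne'
      have h := lp.norm_mono h0
        (x := (⟨fun k => m k * x k, memlp_mul C hm (lp.memℓp x)⟩ : Ellq q))
        (y := ((C : ℂ) • x : Ellq q)) (fun k => by
          change ‖m k * x k‖ ≤ ‖(C : ℂ) * x k‖
          rw [norm_mul, norm_mul]
          refine mul_le_mul_of_nonneg_right ((hm k).trans ?_) (norm_nonneg _)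
          simpa using le_abs_self C)
      rw [lp.norm_const_smul h0] at h
      simpa [abs_of_nonneg hC] using h)

@[simp] theorem mulCLM_apply {q : ℝ} [Fact (1 ≤ q)] (m : ℕ → ℂ) (C : ℝ) (hm : ∀ k, ‖m k‖ ≤ C)
    (x : Ellq q) (k : ℕ) : mulCLM m C hm x k = m k * x k := rfl

/-- The diagonal operator `A` on `ℓ^q` with eigenvalues `lam k`, the canonical unit vectors being
the eigenvectors, on its maximal domain `D(A) = {x ∈ ℓ^q | (lam k * x k) ∈ ℓ^q}`. -/
def diagOp (lam : ℕ → LeftHP) (q : ℝ) [Fact (1 ≤ q)] : Ellq q →ₗ.[ℂ] Ellq q where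
  domain :=
    { carrier := {x | Memℓp (fun k => (lam k : ℂ) * x k) (ENNReal.ofReal q)}
      add_mem' := fun {x y} hx hy => by
        have h := hx.add hy
        refine (congrArg (fun f : ℕ → ℂ => Memℓp f (ENNReal.ofReal q)) ?_).mp h
        funext k
        exact (mul_add (lam k : ℂ) (x k) (y k)).symm
      zero_mem' := by
        refine (congrArg (fun f : ℕ → ℂ => Memℓp f (ENNReal.ofReal q)) ?_).mp zero_memℓp
        funext k
        exact (mul_zero (lam k : ℂ)).symm
      smul_mem' := fun c x hx => by
        have h := hx.const_mul c
        refine (congrArg (fun f : ℕ → ℂ => Memℓp f (ENNReal.ofReal q)) ?_).mp h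
        funext k
        exact mul_left_comm c (lam k : ℂ) (x k) }
  toFun :=
    { toFun := fun x => ⟨fun k => (lam k : ℂ) * x.1 k, x.2⟩
      map_add' := fun x y => by
        apply lp.ext; funext k
        exact mul_add (lam k : ℂ) (x.1 k) (y.1 k)
      map_smul' := fun c x => by
        apply lp.ext; funext k
        exact mul_left_comm (lam k : ℂ) c (x.1 k) }

/-- The sequences `x` for which `(1 - A)⁻¹ x`, computed coordinatewise, lies in `ℓ^q`. -/
def extrapSubmodule (lam : ℕ → LeftHP) (q : ℝ) : Submodule ℂ (ℕ → ℂ) where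
  carrier := {x | Memℓp (fun k => x k / (1 - (lam k : ℂ))) (ENNReal.ofReal q)}
  add_mem' := fun {x y} hx hy => by
    have h := hx.add hy
    refine (congrArg (fun f : ℕ → ℂ => Memℓp f (ENNReal.ofReal q)) ?_).mp h
    funext k
    exact (add_div (x k) (y k) _).symm
  zero_mem' := by
    refine (congrArg (fun f : ℕ → ℂ => Memℓp f (ENNReal.ofReal q)) ?_).mp zero_memℓp
    funext k
    exact (zero_div _).symm
  smul_mem' := fun c x hx => by
    have h := hx.const_mul c
    refine (congrArg (fun f : ℕ → ℂ => Memℓp f (ENNReal.ofReal q)) ?_).mp h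
    funext k
    exact (mul_div_assoc c (x k) _).symm

/-- The extrapolation space of the diagonal operator `A` (written `D(A^*)'` in control theory):
the completion of `ℓ^q` for the norm `‖(1 - A)⁻¹ x‖`, realised as a space of sequences.
The norm is installed below; `denseRange_embed`, `norm_embed` and the completeness instance show
that this is the completion. -/
def Extrap (lam : ℕ → LeftHP) (q : ℝ) : Type := ↥(extrapSubmodule lam q)

namespace Extrap

variable {lam : ℕ → LeftHP} {q : ℝ}

instance : AddCommGroup (Extrap lam q) := inferInstanceAs (AddCommGroup ↥(extrapSubmodule lam q))

instance : Module ℂ (Extrap lam q) := inferInstanceAs (Module ℂ ↥(extrapSubmodule lam q))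

instance : CoeFun (Extrap lam q) (fun _ => ℕ → ℂ) := ⟨fun x => x.1⟩

theorem ext {x y : Extrap lam q} (h : ∀ k, x k = y k) : x = y := Subtype.ext (funext h)

/-- The map `(1 - A)⁻¹` from the extrapolation space to `ℓ^q`, as a linear bijection. -/
def resOne (lam : ℕ → LeftHP) (q : ℝ) : Extrap lam q ≃ₗ[ℂ] Ellq q where
  toFun := fun x => ⟨fun k => x k / (1 - (lam k : ℂ)), x.2⟩
  invFun := fun y => ⟨fun k => y k * (1 - (lam k : ℂ)), by
    refine (congrArg (fun f : ℕ → ℂ => Memℓp f (ENNReal.ofReal q)) ?_).mp (lp.memℓp y)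
    funext k
    exact (mul_div_cancel_right₀ _ (one_sub_ne_zero (lam k))).symm⟩
  left_inv := fun x => ext fun k => div_mul_cancel₀ (x k) (one_sub_ne_zero (lam k))
  right_inv := fun y => by
    apply lp.ext; funext k
    exact mul_div_cancel_right₀ (y k) (one_sub_ne_zero (lam k))
  map_add' := fun x y => by
    apply lp.ext; funext k
    exact add_div (x k) (y k) _
  map_smul' := fun c x => by
    apply lp.ext; funext k
    exact mul_div_assoc c (x k) _

variable [Fact (1 ≤ q)]

/-- The norm `‖x‖ = ‖(1 - A)⁻¹ x‖` of the extrapolation space. -/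
instance : NormedAddCommGroup (Extrap lam q) :=
  NormedAddCommGroup.induced (Extrap lam q) (Ellq q) (resOne lam q) (resOne lam q).injective

instance : NormedSpace ℂ (Extrap lam q) :=
  NormedSpace.induced ℂ (Extrap lam q) (Ellq q) (resOne lam q)

/-- `(1 - A)⁻¹` is an isometric isomorphism from the extrapolation space onto `ℓ^q`. -/
def resOneIso (lam : ℕ → LeftHP) (q : ℝ) [Fact (1 ≤ q)] : Extrap lam q ≃ₗᵢ[ℂ] Ellq q :=
  { resOne lam q with norm_map' := fun _ => rfl }

theorem resOneIso_apply (x : Extrap lam q) (k : ℕ) :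
    resOneIso lam q x k = x k / (1 - (lam k : ℂ)) := rfl

theorem resOneIso_symm_apply (y : Ellq q) (k : ℕ) :
    (resOneIso lam q).symm y k = y k * (1 - (lam k : ℂ)) := rfl

instance : CompleteSpace (Extrap lam q) :=
  (completeSpace_congr (e := (resOneIso lam q).toEquiv)
    (resOneIso lam q).isometry.isUniformEmbedding).mpr inferInstance

end Extrap

variable (lam : ℕ → LeftHP) (q : ℝ) [Fact (1 ≤ q)]

theorem norm_sub_ge (l : LeftHP) (s : ℝ) : s ≤ ‖(s : ℂ) - l‖ := by
  have h := Complex.re_le_norm ((s : ℂ) - l)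
  have h2 := l.2
  simp at h
  linarith

theorem one_le_norm_sub (l : LeftHP) : 1 ≤ ‖(1 : ℂ) - l‖ := by simpa using norm_sub_ge l 1

/-- The inclusion of `ℓ^q` into the extrapolation space. -/
def embed : Ellq q →L[ℂ] Extrap lam q :=
  (Extrap.resOneIso lam q).symm.toContinuousLinearEquiv.toContinuousLinearMap.comp
    (mulCLM (fun k => (1 - (lam k : ℂ))⁻¹) 1 fun k => by
      rw [norm_inv]
      exact inv_le_one_of_one_le₀ (one_le_norm_sub (lam k)))

@[simp] theorem embed_apply (x : Ellq q) (k : ℕ) : embed lam q x k = x k := by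
  change (1 - (lam k : ℂ))⁻¹ * x k * (1 - (lam k : ℂ)) = x k
  field_simp [one_sub_ne_zero (lam k)]

/-- The extension to the extrapolation space of the semigroup `T(t)` generated by `A`:
`(T(t) x) k = exp (lam k * t) * x k`. -/
def semigroup (t : ℝ≥0) : Extrap lam q →L[ℂ] Extrap lam q :=
  (Extrap.resOneIso lam q).symm.toContinuousLinearEquiv.toContinuousLinearMap.comp
    ((mulCLM (fun k => Complex.exp ((lam k : ℂ) * (t : ℝ))) 1 fun k => by
      rw [Complex.norm_exp]
      have h : ((lam k : ℂ) * ((t : ℝ) : ℂ)).re = (lam k : ℂ).re * t := by simp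
      rw [h, Real.exp_le_one_iff]
      exact mul_nonpos_of_nonpos_of_nonneg (lam k).2.le t.2).comp
    (Extrap.resOneIso lam q).toContinuousLinearEquiv.toContinuousLinearMap)

@[simp] theorem semigroup_apply (t : ℝ≥0) (x : Extrap lam q) (k : ℕ) :
    semigroup lam q t x k = Complex.exp ((lam k : ℂ) * (t : ℝ)) * x k := by
  change Complex.exp ((lam k : ℂ) * (t : ℝ)) * (x k / (1 - (lam k : ℂ))) * (1 - (lam k : ℂ)) = _
  field_simp [one_sub_ne_zero (lam k)]

theorem norm_ratio_le (l : LeftHP) (s : ℝ) {r : ℝ} (hr : 0 < r) :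
    ‖((s : ℂ) - l) / ((r : ℂ) - l)‖ ≤ 1 + |s - r| / r := by
  have hne := sub_ne_zero_of_pos l hr
  have h : ((s : ℂ) - l) / ((r : ℂ) - l) = 1 + ((s - r : ℝ) : ℂ) / ((r : ℂ) - l) := by
    field_simp
    push_cast
    ring
  rw [h]
  refine (norm_add_le _ _).trans ?_
  rw [norm_one, norm_div, Complex.norm_real, Real.norm_eq_abs]
  gcongr
  exact norm_sub_ge l r

/-- For `s > 0`, the extension of `s - A` to an isomorphism from `ℓ^q` onto the extrapolation
space. Its inverse is the extension of the resolvent `(s - A)⁻¹` to the extrapolation space. -/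
def shiftEquiv (s : ℝ) (hs : 0 < s) : Ellq q ≃L[ℂ] Extrap lam q :=
  (ContinuousLinearEquiv.equivOfInverse
    (mulCLM (q := q) (fun k => ((s : ℂ) - lam k) / (((1 : ℝ) : ℂ) - lam k)) _
      fun k => norm_ratio_le (lam k) s one_pos)
    (mulCLM (fun k => (((1 : ℝ) : ℂ) - lam k) / ((s : ℂ) - lam k)) _
      fun k => norm_ratio_le (lam k) 1 hs)
    (fun x => by
      apply lp.ext; funext k
      have h1 := sub_ne_zero_of_pos (lam k) hs
      have h2 := sub_ne_zero_of_pos (lam k) one_pos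
      simp only [mulCLM_apply]
      field_simp)
    (fun x => by
      apply lp.ext; funext k
      have h1 := sub_ne_zero_of_pos (lam k) hs
      have h2 := sub_ne_zero_of_pos (lam k) one_pos
      simp only [mulCLM_apply]
      field_simp)).trans
  (Extrap.resOneIso lam q).symm.toContinuousLinearEquiv

theorem shiftEquiv_apply (s : ℝ) (hs : 0 < s) (x : Ellq q) (k : ℕ) :
    shiftEquiv lam q s hs x k = ((s : ℂ) - lam k) * x k := by
  change ((s : ℂ) - lam k) / (((1 : ℝ) : ℂ) - lam k) * x k * (1 - (lam k : ℂ)) = _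
  have := one_sub_ne_zero (lam k)
  push_cast
  field_simp

/-- On `D(A)`, the operator `shiftEquiv` is `s - A`. -/
theorem shiftEquiv_eq (s : ℝ) (hs : 0 < s) (x : (diagOp lam q).domain) :
    shiftEquiv lam q s hs x = embed lam q ((s : ℂ) • (x : Ellq q) - diagOp lam q x) := by
  refine Extrap.ext fun k => ?_
  rw [shiftEquiv_apply, embed_apply]
  exact sub_mul (s : ℂ) (lam k : ℂ) (x.1 k)

/-- The resolvent `(s - A)⁻¹`, extended to the extrapolation space, with values in `ℓ^q`. -/
def resolvent (s : ℝ) (hs : 0 < s) : Extrap lam q →L[ℂ] Ellq q :=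
  (shiftEquiv lam q s hs).symm.toContinuousLinearMap

@[simp] theorem resolvent_apply (s : ℝ) (hs : 0 < s) (x : Extrap lam q) (k : ℕ) :
    resolvent lam q s hs x k = x k / ((s : ℂ) - lam k) := by
  have h : shiftEquiv lam q s hs (resolvent lam q s hs x) = x :=
    (shiftEquiv lam q s hs).apply_symm_apply x
  have h2 := shiftEquiv_apply lam q s hs (resolvent lam q s hs x) k
  rw [h] at h2
  rw [h2, mul_div_cancel_left₀ _ (sub_ne_zero_of_pos (lam k) hs)]

/-- The norm of the extrapolation space restricts to `‖(1 - A)⁻¹ x‖` on `ℓ^q`. -/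
theorem norm_embed (x : Ellq q) :
    ‖embed lam q x‖ = ‖resolvent lam q 1 one_pos (embed lam q x)‖ := by
  rw [← (Extrap.resOneIso lam q).norm_map]
  congr 1
  apply lp.ext; funext k
  rw [resolvent_apply, Extrap.resOneIso_apply]
  push_cast
  rfl

theorem denseRange_embed : DenseRange (embed lam q) := by
  intro x
  have hs := lp.hasSum_single (p := ENNReal.ofReal q) ENNReal.ofReal_ne_top
    (Extrap.resOneIso lam q x)
  have h2 := hs.map (Extrap.resOneIso lam q).symm
    (Extrap.resOneIso lam q).symm.continuous
  rw [LinearIsometryEquiv.symm_apply_apply] at h2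
  refine mem_closure_of_tendsto h2 (Eventually.of_forall fun s => ?_)
  refine ⟨∑ i ∈ s, lp.single (ENNReal.ofReal q) i (x i), ?_⟩
  rw [map_sum]
  refine Finset.sum_congr rfl fun i _ => Extrap.ext fun k => ?_
  rw [embed_apply, Function.comp_apply, Extrap.resOneIso_symm_apply]
  by_cases hk : k = i
  · subst hk
    rw [lp.single_apply_self, lp.single_apply_self, Extrap.resOneIso_apply,
      div_mul_cancel₀ _ (one_sub_ne_zero (lam k))]
  · rw [lp.single_apply_ne _ _ _ hk, lp.single_apply_ne _ _ _ hk, zero_mul]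

/-- `B` is an (infinite-time) admissible control operator with respect to `L^p(0,∞)`: for every
input `u ∈ L^p(0,∞)` the integral `∫_0^∞ T(t) B u(t) dt`, taken in the extrapolation space as
`lim_{τ → ∞} ∫_0^τ`, exists and belongs to `ℓ^q`, with `ℓ^q`-norm at most `m₀ ‖u‖_{L^p(0,∞)}`. -/
def IsAdmissible (p : ℝ) (B : ℂ →L[ℂ] Extrap lam q) : Prop :=
  ∃ m₀ : ℝ, 0 < m₀ ∧ ∀ u : ℝ → ℂ,
    MemLp u (ENNReal.ofReal p) (volume.restrict (Set.Ioi 0)) →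
      (∀ τ : ℝ, 0 < τ →
        IntervalIntegrable (fun t => semigroup lam q t.toNNReal (B (u t))) volume 0 τ) ∧
      ∃ x : Ellq q,
        Tendsto (fun τ : ℝ => ∫ t in (0 : ℝ)..τ, semigroup lam q t.toNNReal (B (u t)))
          atTop (𝓝 (embed lam q x)) ∧
        ‖x‖ ≤ m₀ * (eLpNorm u (ENNReal.ofReal p) (volume.restrict (Set.Ioi 0))).toReal

/-- The measure `μ = ∑ k, |b k|^q δ_{-lam k}`, where `(b k)` is the sequence of `B`. -/
def controlMeasure (B : ℂ →L[ℂ] Extrap lam q) : Measure ℂ :=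
  Measure.sum fun k => ENNReal.ofReal (‖B 1 k‖ ^ q) • Measure.dirac (-(lam k : ℂ))

/-- The sector `S(θ) = {z ∈ ℂ₊ : |arg z| < θ}`. -/
def sector (θ : ℝ) : Set ℂ := {z | 0 < z.re ∧ |z.arg| < θ}

/-- The vertical strip `S_n = {z : 2^(n-1) < Re z ≤ 2^n}`. -/
def strip (n : ℤ) : Set ℂ := {z | (2 : ℝ) ^ (n - 1) < z.re ∧ z.re ≤ (2 : ℝ) ^ n}

/-- The Poisson kernel `p_z(t)` of the right half-plane at the boundary point `i t`. -/
def poissonRHP (z : ℂ) (t : ℝ) : ℝ := (1 / Real.pi) * (z.re / (z.re ^ 2 + (t - z.im) ^ 2))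

/-- The balayage `S_μ(t) = ∫_{ℂ₊} p_z(t) dμ(z)`, with values in `[0,∞]`. -/
def balayage (μ : Measure ℂ) (t : ℝ) : ℝ≥0∞ :=
  ∫⁻ z in {z : ℂ | 0 < z.re}, ENNReal.ofReal (poissonRHP z t) ∂μ

end DiagSystem

end

/-! All four conditions are compared with one sequence, W_n = 2^(-nq/p') μ(S_n) (`stripWeight`), and
each is shown to be equivalent to W ∈ ℓ^r with r = p/(p-q). The k-th coordinate of ∫ T(t)Bu(t) dt is
b_k times the Laplace transform of u at -λ_k. Admissibility is therefore a Carleson embedding of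
L^p(0,∞) into L^q(μ) by the Laplace transform.

If -λ_k ∈ S_n, then |exp(λ_k t)| ≤ exp(-2^n t/2). The numbers I_n = 2^(n/p') ∫ exp(-2^n t/2)|u(t)|
dt form an ℓ^p sequence with norm controlled by ‖u‖_p, by a Schur test with power weights
(`exists_tsum_laplace_le`). Hölder's inequality with exponents r and p/q bounds Σ W_n I_n^q, so W ∈
ℓ^r implies admissibility.

Conversely, the inputs u = Σ c_n 2^(n/p) exp(-2^n t/2), c_n ≥ 0, have L^p norm controlled by the ℓ^p
norm of c (`exists_lintegral_expSum_le`). Their Laplace transforms are sums of terms with positive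
real part in the sector, so nothing cancels and on S_n the transform is at least a constant times
2^(-n/p') c_n. Admissibility gives Σ W_n c_n^q ≤ M (Σ c_n^p)^(q/p), and duality gives W ∈ ℓ^r.

The resolvent and balayage conditions concern sequences dominated by Σ_m φ(2^n/2^m) W_m, where φ
decays like a power at 0 and at ∞. Such dyadic convolutions are bounded on ℓ^r, and the diagonal
term m = n gives the reverse estimate. For the balayage, decay of φ at 0 is exactly q < p'. -/

noncomputable section

namespace DiagSystem

/-! ### Schur tests, Hölder and duality for sums -/

/-- A function on `(0,∞)` with power decay at `0` and at `∞` has uniformly bounded dyadic sums. -/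
theorem exists_tsum_dyadic_le {φ : ℝ → ℝ} {a b C : ℝ} (ha : 0 < a) (hb : 0 < b) (hC : 0 ≤ C)
    (h1 : ∀ x, 0 < x → φ x ≤ C * x ^ a) (h2 : ∀ x, 0 < x → φ x ≤ C * x ^ (-b)) :
    ∃ M : ℝ≥0∞, M ≠ ⊤ ∧ ∀ s, 0 < s → ∑' n : ℤ, ENNReal.ofReal (φ ((2 : ℝ) ^ n * s)) ≤ M := by
  set c := min a b with hc
  have hc0 : 0 < c := lt_min ha hb
  set ρ : ℝ := (2 : ℝ) ^ (-c) with hρ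
  have hρ0 : 0 < ρ := by positivity
  have hρ1 : ρ < 1 := Real.rpow_lt_one_of_one_lt_of_neg one_lt_two (by linarith)
  have hpow : ∀ m : ℕ, ρ ^ m = (2 : ℝ) ^ (-c * m) := fun m => by
    rw [hρ, ← Real.rpow_natCast, ← Real.rpow_mul two_pos.le]
  have hsum : Summable fun n : ℤ => C * 2 ^ a * ρ ^ n.natAbs := by
    refine Summable.mul_left _ (Summable.of_nat_of_neg ?_ ?_) <;>
    simpa using summable_geometric_of_lt_one hρ0.le hρ1
  have h2a : (1 : ℝ) ≤ 2 ^ a := Real.one_le_rpow one_le_two ha.le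
  refine ⟨_, hsum.tsum_ofReal_ne_top, fun s hs => ?_⟩
  -- Shifting the index by k, where 2^k ≤ s < 2^(k+1), replaces s by σ ∈ [1,2], which makes the
  -- bound independent of s. The factor 2^a in the majorant absorbs σ^a.
  obtain ⟨k, hk1, hk2⟩ := exists_mem_Ico_zpow hs (one_lt_two (α := ℝ))
  rw [← (Equiv.subRight k).tsum_eq fun n : ℤ => ENNReal.ofReal (φ ((2 : ℝ) ^ n * s))]
  refine ENNReal.tsum_le_tsum fun n => ENNReal.ofReal_le_ofReal ?_
  have hk0 : (0 : ℝ) < 2 ^ k := by positivity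
  set σ := s / 2 ^ k with hσ
  have hσ1 : 1 ≤ σ := by rwa [hσ, one_le_div hk0]
  have hσ2 : σ ≤ 2 := by
    rw [hσ, div_le_iff₀ hk0]; rw [zpow_add_one₀ two_ne_zero] at hk2; linarith
  have hx : (2 : ℝ) ^ (Equiv.subRight k n) * s = 2 ^ n * σ := by
    simp only [Equiv.subRight_apply, hσ]
    rw [zpow_sub₀ two_ne_zero]; ring
  rw [hx]
  have hn0 : (0 : ℝ) < 2 ^ n := by positivity
  have hσ0 : 0 < σ := by linarith
  have hx0 : 0 < 2 ^ n * σ := by positivity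
  rw [mul_assoc]
  rcases le_or_gt 0 n with hn | hn
  · refine (h2 _ hx0).trans (mul_le_mul_of_nonneg_left ?_ hC)
    have e : ρ ^ n.natAbs = ((2 : ℝ) ^ n) ^ (-c) := by
      rw [hpow, ← Real.rpow_intCast, ← Real.rpow_mul two_pos.le]
      congr 1
      rw [Nat.cast_natAbs, abs_of_nonneg hn]; ring
    have h1n : (1 : ℝ) ≤ 2 ^ n := one_le_zpow₀ one_le_two hn
    calc (2 ^ n * σ) ^ (-b) ≤ ((2 : ℝ) ^ n) ^ (-b) :=
          Real.rpow_le_rpow_of_nonpos hn0 (le_mul_of_one_le_right hn0.le hσ1) (by linarith)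
      _ ≤ ((2 : ℝ) ^ n) ^ (-c) :=
          Real.rpow_le_rpow_of_exponent_le h1n (neg_le_neg (min_le_right _ _))
      _ = ρ ^ n.natAbs := e.symm
      _ ≤ 2 ^ a * ρ ^ n.natAbs := le_mul_of_one_le_left (by positivity) h2a
  · refine (h1 _ hx0).trans (mul_le_mul_of_nonneg_left ?_ hC)
    have e : ρ ^ n.natAbs = ((2 : ℝ) ^ n) ^ c := by
      rw [hpow, ← Real.rpow_intCast, ← Real.rpow_mul two_pos.le]
      congr 1
      rw [Nat.cast_natAbs, abs_of_neg hn]; push_cast; ring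
    rw [Real.mul_rpow hn0.le hσ0.le, mul_comm]
    refine mul_le_mul (Real.rpow_le_rpow hσ0.le hσ2 ha.le) ?_ (by positivity) (by positivity)
    rw [e]
    exact Real.rpow_le_rpow_of_exponent_ge hn0 (zpow_le_one_of_nonpos₀ one_le_two hn.le)
      (min_le_left _ _)

/-- The weighted Schur test for a nonnegative kernel. -/
theorem lintegral_rpow_le_of_schur {X Y : Type*} [MeasurableSpace X] [MeasurableSpace Y]
    {μ : Measure X} {ν : Measure Y} [SFinite μ] [SFinite ν] {p p' : ℝ}
    (hp : p.HolderConjugate p') {K : X → Y → ℝ≥0∞} (hK : Measurable (Function.uncurry K))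
    {g : X → ℝ≥0∞} {h : Y → ℝ≥0∞} (hg : Measurable g) (hh : Measurable h)
    (hh0 : ∀ᵐ y ∂ν, h y ≠ 0 ∧ h y ≠ ⊤) {C₁ C₂ : ℝ≥0∞}
    (H₁ : ∀ᵐ x ∂μ, ∫⁻ y, K x y * h y ^ p' ∂ν ≤ C₁ * g x ^ p')
    (H₂ : ∀ᵐ y ∂ν, ∫⁻ x, K x y * g x ^ p ∂μ ≤ C₂ * h y ^ p)
    {f : Y → ℝ≥0∞} (hf : Measurable f) :
    ∫⁻ x, (∫⁻ y, K x y * f y ∂ν) ^ p ∂μ ≤ C₁ ^ (p - 1) * C₂ * ∫⁻ y, f y ^ p ∂ν := by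
  have hp0 : 0 < p := hp.pos
  have hp0' : 0 < p' := hp.symm.pos
  have hKx : ∀ x, Measurable (K x) := fun x => hK.comp measurable_prodMk_left
  have hKy : ∀ y, Measurable fun x => K x y := fun y => hK.comp measurable_prodMk_right
  have hpp : p / p' = p - 1 := by
    have := hp.sub_one_mul_conj
    field_simp
    linarith
  have step : ∀ᵐ x ∂μ, (∫⁻ y, K x y * f y ∂ν) ^ p ≤
      C₁ ^ (p - 1) * ∫⁻ y, K x y * g x ^ p * (f y ^ p * (h y)⁻¹ ^ p) ∂ν := by
    filter_upwards [H₁] with x hx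
    -- Hölder is applied to the splitting K f = (K^(1/p') h)(K^(1/p) f h⁻¹). The first factor is
    -- controlled by `H₁`, and g^(p'(p-1)) = g^p prepares the use of `H₂` after Tonelli.
    have e1 : ∫⁻ y, K x y * f y ∂ν =
        ∫⁻ y, (fun y => K x y ^ (1 / p') * h y) y * (fun y => K x y ^ (1 / p) * f y * (h y)⁻¹) y ∂ν := by
      refine lintegral_congr_ae ?_
      filter_upwards [hh0] with y hy
      have hKK : K x y ^ (1 / p') * K x y ^ (1 / p) = K x y := by
        rw [← ENNReal.rpow_add_of_nonneg _ _ (by positivity) (by positivity)]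
        have : 1 / p' + 1 / p = 1 := by simpa [add_comm] using hp.inv_add_inv_eq_one
        rw [this, ENNReal.rpow_one]
      calc K x y * f y = (K x y ^ (1 / p') * K x y ^ (1 / p)) * f y * (h y * (h y)⁻¹) := by
            rw [hKK, ENNReal.mul_inv_cancel hy.1 hy.2, mul_one]
        _ = _ := by ring
    have e2 := ENNReal.lintegral_mul_le_Lp_mul_Lq ν hp.symm
      (f := fun y => K x y ^ (1 / p') * h y) (g := fun y => K x y ^ (1 / p) * f y * (h y)⁻¹)
      (((hKx x).pow_const _).mul hh).aemeasurable
      ((((hKx x).pow_const _).mul hf).mul hh.inv).aemeasurable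
    have e3 : ∀ y, (K x y ^ (1 / p') * h y) ^ p' = K x y * h y ^ p' := fun y => by
      rw [ENNReal.mul_rpow_of_nonneg _ _ hp0'.le, ← ENNReal.rpow_mul,
        one_div_mul_cancel hp0'.ne', ENNReal.rpow_one]
    have e4 : ∀ y, (K x y ^ (1 / p) * f y * (h y)⁻¹) ^ p = K x y * (f y ^ p * (h y)⁻¹ ^ p) :=
      fun y => by
      rw [ENNReal.mul_rpow_of_nonneg _ _ hp0.le, ENNReal.mul_rpow_of_nonneg _ _ hp0.le,
        ← ENNReal.rpow_mul, one_div_mul_cancel hp0.ne', ENNReal.rpow_one, mul_assoc]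
    simp only [Pi.mul_apply, e3, e4] at e2
    rw [e1]
    calc _ ≤ ((∫⁻ y, K x y * h y ^ p' ∂ν) ^ (1 / p') *
            (∫⁻ y, K x y * (f y ^ p * (h y)⁻¹ ^ p) ∂ν) ^ (1 / p)) ^ p :=
          ENNReal.rpow_le_rpow e2 hp0.le
      _ = (∫⁻ y, K x y * h y ^ p' ∂ν) ^ (p - 1) * ∫⁻ y, K x y * (f y ^ p * (h y)⁻¹ ^ p) ∂ν := by
          rw [ENNReal.mul_rpow_of_nonneg _ _ hp0.le, ← ENNReal.rpow_mul, ← ENNReal.rpow_mul,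
            one_div_mul_cancel hp0.ne', ENNReal.rpow_one, ← hpp]
          congr 2
          ring
      _ ≤ (C₁ * g x ^ p') ^ (p - 1) * ∫⁻ y, K x y * (f y ^ p * (h y)⁻¹ ^ p) ∂ν := by
          gcongr
          exact hp.sub_one_pos.le
      _ = C₁ ^ (p - 1) * ∫⁻ y, K x y * g x ^ p * (f y ^ p * (h y)⁻¹ ^ p) ∂ν := by
          rw [ENNReal.mul_rpow_of_nonneg _ _ hp.sub_one_pos.le, ← ENNReal.rpow_mul, ← hpp,
            mul_div_cancel₀ _ hp0'.ne', mul_assoc, ← lintegral_const_mul]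
          · congr 2
            funext y
            ring
          · exact (hKx x).mul ((hf.pow_const _).mul (hh.inv.pow_const _))
  refine (lintegral_mono_ae step).trans ?_
  have hm : Measurable (Function.uncurry fun x y => K x y * g x ^ p * (f y ^ p * (h y)⁻¹ ^ p)) :=
    (hK.mul ((hg.pow_const _).comp measurable_fst)).mul
      (((hf.pow_const _).mul (hh.inv.pow_const _)).comp measurable_snd)
  have hm' : Measurable fun x => ∫⁻ y, K x y * g x ^ p * (f y ^ p * (h y)⁻¹ ^ p) ∂ν :=
    hm.lintegral_prod_right'
  rw [lintegral_const_mul _ hm', lintegral_lintegral_swap hm.aemeasurable, mul_assoc]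
  gcongr
  rw [← lintegral_const_mul _ (hf.pow_const _)]
  refine lintegral_mono_ae ?_
  filter_upwards [H₂, hh0] with y hy hy0
  have hKg : Measurable fun x => K x y * g x ^ p := (hKy y).mul (hg.pow_const _)
  rw [lintegral_mul_const _ hKg]
  calc (∫⁻ x, K x y * g x ^ p ∂μ) * (f y ^ p * (h y)⁻¹ ^ p)
      ≤ C₂ * h y ^ p * (f y ^ p * (h y)⁻¹ ^ p) := by gcongr
    _ = C₂ * f y ^ p * (h y * (h y)⁻¹) ^ p := by
        rw [ENNReal.mul_rpow_of_nonneg _ _ hp0.le]; ring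
    _ = C₂ * f y ^ p := by
        rw [ENNReal.mul_inv_cancel hy0.1 hy0.2, ENNReal.one_rpow, mul_one]

/-- The Schur test with trivial weights for discrete kernels. -/
theorem tsum_rpow_le_of_schur {ι κ : Type*} [Countable ι] [Countable κ] {p p' : ℝ}
    (hp : p.HolderConjugate p') (K : ι → κ → ℝ≥0∞) {C₁ C₂ : ℝ≥0∞}
    (H₁ : ∀ i, ∑' j, K i j ≤ C₁) (H₂ : ∀ j, ∑' i, K i j ≤ C₂) (f : κ → ℝ≥0∞) :
    ∑' i, (∑' j, K i j * f j) ^ p ≤ C₁ ^ (p - 1) * C₂ * ∑' j, f j ^ p := by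
  let _ : MeasurableSpace ι := ⊤
  let _ : MeasurableSpace κ := ⊤
  have : MeasurableSingletonClass ι := ⟨fun _ => trivial⟩
  have : MeasurableSingletonClass κ := ⟨fun _ => trivial⟩
  have h := lintegral_rpow_le_of_schur (μ := Measure.count) (ν := Measure.count) hp (K := K)
    (measurable_of_countable _) (g := fun _ => 1) (h := fun _ => 1) measurable_const
    measurable_const (by simp) (C₁ := C₁) (C₂ := C₂) (by simpa [lintegral_count] using H₁)
    (by simpa [lintegral_count] using H₂) (f := f) (measurable_of_countable _)
  simpa only [lintegral_count] using h

/-- Hölder's inequality for sums of extended nonnegative reals. -/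
theorem tsum_mul_le_Lp_mul_Lq {ι : Type*} [Countable ι] {p p' : ℝ} (hp : p.HolderConjugate p')
    (f g : ι → ℝ≥0∞) :
    ∑' i, f i * g i ≤ (∑' i, f i ^ p) ^ (1 / p) * (∑' i, g i ^ p') ^ (1 / p') := by
  let _ : MeasurableSpace ι := ⊤
  have : MeasurableSingletonClass ι := ⟨fun _ => trivial⟩
  have h := ENNReal.lintegral_mul_le_Lp_mul_Lq (Measure.count : Measure ι) hp
    (f := f) (g := g) (measurable_of_countable _).aemeasurable
    (measurable_of_countable _).aemeasurable
  simpa only [lintegral_count, Pi.mul_apply] using h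

/-- The converse of Hölder's inequality. The extremal choice c_i = w_i^(1/(p-q)) makes both w c^q
and c^p equal to w^(p/(p-q)), so the finite sum S over F satisfies S ≤ M S^(q/p). Dividing is
legitimate because S is finite, and the resulting bound M^(p/(p-q)) does not depend on F. -/
theorem tsum_rpow_ne_top_of_forall_finset {ι : Type*} {p q : ℝ} (hq : 0 < q) (hqp : q < p)
    {w : ι → ℝ≥0∞} {M : ℝ≥0∞} (hM : M ≠ ⊤)
    (h : ∀ (F : Finset ι) (c : ι → ℝ≥0),
      ∑ i ∈ F, w i * (c i : ℝ≥0∞) ^ q ≤ M * (∑ i ∈ F, (c i : ℝ≥0∞) ^ p) ^ (q / p)) :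
    ∑' i, w i ^ (p / (p - q)) ≠ ⊤ := by
  have hw : ∀ i, w i ≠ ⊤ := fun i =>
    ne_top_of_le_ne_top hM (by simpa using h {i} fun _ => 1)
  have hpq : 0 < p - q := by linarith
  have hp : 0 < p := by linarith
  have hr : 0 < p / (p - q) := by positivity
  have hMr : M ^ (p / (p - q)) ≠ ⊤ := ENNReal.rpow_ne_top_of_nonneg hr.le hM
  refine ne_top_of_le_ne_top hMr ?_
  rw [ENNReal.tsum_eq_iSup_sum]
  refine iSup_le fun F => ?_
  have hF := h F fun i => ((w i) ^ (1 / (p - q))).toNNReal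
  have hc : ∀ i, (((w i) ^ (1 / (p - q))).toNNReal : ℝ≥0∞) = (w i) ^ (1 / (p - q)) := fun i =>
    ENNReal.coe_toNNReal (ENNReal.rpow_ne_top_of_nonneg (by positivity) (hw i))
  have e1 : ∀ i, w i * ((w i) ^ (1 / (p - q))) ^ q = w i ^ (p / (p - q)) := fun i => by
    rw [← ENNReal.rpow_mul]
    nth_rewrite 1 [← ENNReal.rpow_one (w i)]
    rw [← ENNReal.rpow_add_of_nonneg _ _ zero_le_one (by positivity)]
    congr 1
    field_simp
    ring
  have e2 : ∀ i, ((w i) ^ (1 / (p - q))) ^ p = w i ^ (p / (p - q)) := fun i => by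
    rw [← ENNReal.rpow_mul]
    congr 1
    ring
  simp only [hc, e1, e2] at hF
  set S := ∑ i ∈ F, w i ^ (p / (p - q)) with hS
  have hSt : S ≠ ⊤ := by
    rw [hS, ENNReal.sum_ne_top]
    exact fun i _ => ENNReal.rpow_ne_top_of_nonneg hr.le (hw i)
  rcases eq_or_ne S 0 with h0 | h0
  · simp [h0]
  have h3 : S ^ ((p - q) / p) ≤ M := by
    have e : S = S ^ ((p - q) / p) * S ^ (q / p) := by
      rw [← ENNReal.rpow_add _ _ h0 hSt]
      have : (p - q) / p + q / p = 1 := by field_simp; ring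
      rw [this, ENNReal.rpow_one]
    have hS0 : S ^ (q / p) ≠ 0 := by simp [h0, hSt]
    have hS1 : S ^ (q / p) ≠ ⊤ := ENNReal.rpow_ne_top_of_nonneg (by positivity) hSt
    refine (ENNReal.mul_le_mul_iff_left hS0 hS1).1 ?_
    rwa [← e]
  calc S = (S ^ ((p - q) / p)) ^ (p / (p - q)) := by
        rw [← ENNReal.rpow_mul]
        have : (p - q) / p * (p / (p - q)) = 1 := by field_simp
        rw [this, ENNReal.rpow_one]
    _ ≤ _ := ENNReal.rpow_le_rpow h3 hr.le

/-- Finiteness of each term has to accompany `Memℓp`, since `toReal` sends `⊤` to 0 and would hide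
infinite terms. -/
theorem memlp_toReal_iff {ι : Type*} {r : ℝ} (hr : 0 < r) {f : ι → ℝ≥0∞} :
    ((∀ i, f i ≠ ⊤) ∧ Memℓp (fun i => (f i).toReal) (ENNReal.ofReal r)) ↔
      ∑' i, f i ^ r ≠ ⊤ := by
  have hr' : (ENNReal.ofReal r).toReal = r := ENNReal.toReal_ofReal hr.le
  have key : (∀ i, f i ≠ ⊤) → (Memℓp (fun i => (f i).toReal) (ENNReal.ofReal r) ↔
      ∑' i, f i ^ r ≠ ⊤) := fun h => by
    rw [memℓp_gen_iff (by rwa [hr']), hr']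
    have e : ∀ i, f i ^ r = ENNReal.ofReal (‖(f i).toReal‖ ^ r) := fun i => by
      rw [Real.norm_of_nonneg ENNReal.toReal_nonneg,
        ← ENNReal.ofReal_rpow_of_nonneg ENNReal.toReal_nonneg hr.le, ENNReal.ofReal_toReal (h i)]
    simp only [e]
    constructor
    · exact fun hs => hs.tsum_ofReal_ne_top
    · intro hs
      have := ENNReal.summable_toReal hs
      refine this.congr fun i => ?_
      rw [ENNReal.toReal_ofReal (by positivity)]
  constructor
  · exact fun h => (key h.1).1 h.2
  · intro h
    have hf : ∀ i, f i ≠ ⊤ := fun i hi => ENNReal.ne_top_of_tsum_ne_top h i (by simp [hi, hr])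
    exact ⟨hf, (key hf).2 h⟩

/-! ### Dyadic exponentials and the Laplace transform on L^p -/

/-- The dyadic exponential kernel `2^(n α) e^(-2^n t / 2)`. -/
def expKernel (α : ℝ) (n : ℤ) (t : ℝ) : ℝ := ((2 : ℝ) ^ n) ^ α * Real.exp (-((2 : ℝ) ^ n / 2 * t))

theorem expKernel_nonneg (α : ℝ) (n : ℤ) (t : ℝ) : 0 ≤ expKernel α n t := by
  unfold expKernel; positivity

theorem measurable_expKernel (α : ℝ) (n : ℤ) : Measurable (expKernel α n) := by
  unfold expKernel; fun_prop

theorem measurable_uncurry_expKernel (α : ℝ) :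
    Measurable (Function.uncurry fun (n : ℤ) (t : ℝ) => ENNReal.ofReal (expKernel α n t)) :=
  measurable_from_prod_countable_right fun n => (measurable_expKernel α n).ennreal_ofReal

/-- The substitution s = 2^n t removes n: the weight t^(α-1) is the one for which the integral is
scale invariant. -/
theorem lintegral_expKernel {α : ℝ} (hα : 0 < α) (n : ℤ) :
    ∫⁻ t in Set.Ioi (0 : ℝ), ENNReal.ofReal (expKernel α n t) * ENNReal.ofReal (t ^ (α - 1)) =
      ENNReal.ofReal (2 ^ α * Real.Gamma α) := by
  have hn : (0 : ℝ) < 2 ^ n / 2 := by positivity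
  have hI := Real.integral_rpow_mul_exp_neg_mul_Ioi hα hn
  have hint : IntegrableOn (fun t : ℝ => t ^ (α - 1) * Real.exp (-((2 : ℝ) ^ n / 2 * t)))
      (Set.Ioi 0) := by
    by_contra h
    rw [integral_undef h] at hI
    have := Real.Gamma_pos_of_pos hα
    have : 0 < (1 / ((2 : ℝ) ^ n / 2)) ^ α * Real.Gamma α := by positivity
    linarith
  have e : ∀ t ∈ Set.Ioi (0 : ℝ),
      ENNReal.ofReal (expKernel α n t) * ENNReal.ofReal (t ^ (α - 1)) =
        ENNReal.ofReal (((2 : ℝ) ^ n) ^ α * (t ^ (α - 1) * Real.exp (-((2 : ℝ) ^ n / 2 * t)))) :=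
    fun t _ => by
      rw [← ENNReal.ofReal_mul (expKernel_nonneg _ _ _), expKernel]
      congr 1
      ring
  rw [setLIntegral_congr_fun measurableSet_Ioi e,
    ← ofReal_integral_eq_lintegral_ofReal (hint.const_mul _), integral_const_mul, hI, ← mul_assoc,
    ← Real.mul_rpow (by positivity) (by positivity)]
  · congr 3
    field_simp
  · filter_upwards [ae_restrict_mem measurableSet_Ioi] with t ht
    have : (0 : ℝ) < t := ht
    simp only [Pi.zero_apply]
    positivity

/-- After multiplication by t^α the sum becomes Σ φ(2^n t) with φ(x) = x^α exp(-x/2), which decays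
at both ends. -/
theorem exists_tsum_expKernel_le {α : ℝ} (hα : 0 < α) (hα1 : α ≤ 1) :
    ∃ M : ℝ≥0∞, M ≠ ⊤ ∧ ∀ t : ℝ, 0 < t →
      ∑' n : ℤ, ENNReal.ofReal (expKernel α n t) ≤ M * ENNReal.ofReal (t ^ (-α)) := by
  obtain ⟨M, hM, h⟩ := exists_tsum_dyadic_le (φ := fun x => x ^ α * Real.exp (-(x / 2)))
    (a := α) (b := 1) (C := 8) hα one_pos (by norm_num)
    (fun x hx => by
      have : Real.exp (-(x / 2)) ≤ 1 := Real.exp_le_one_iff.2 (by linarith)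
      have h0 : 0 < x ^ α := by positivity
      nlinarith)
    -- For α ≤ 1, x^(α+1) ≤ 1 + x² ≤ 8(1 + x/2 + x²/8) ≤ 8 exp(x/2); this fixes C = 8.
    (fun x hx => by
      have h1 : x ^ (α + 1) ≤ 1 + x ^ 2 := by
        rcases le_or_gt x 1 with h | h
        · have := Real.rpow_le_one hx.le h (z := α + 1) (by linarith)
          nlinarith
        · have := Real.rpow_le_rpow_of_exponent_le h.le (y := α + 1) (z := 2) (by linarith)
          rw [Real.rpow_two] at this
          linarith
      have h2 := Real.quadratic_le_exp_of_nonneg (x := x / 2) (by linarith)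
      rw [Real.exp_neg, Real.rpow_neg_one, ← div_eq_mul_inv, ← div_eq_mul_inv,
        div_le_div_iff₀ (Real.exp_pos _) hx]
      rw [Real.rpow_add_one hx.ne'] at h1
      nlinarith)
  refine ⟨M, hM, fun t ht => ?_⟩
  have e : ∀ n : ℤ, ENNReal.ofReal (expKernel α n t) =
      ENNReal.ofReal (((2 : ℝ) ^ n * t) ^ α * Real.exp (-((2 : ℝ) ^ n * t / 2))) *
        ENNReal.ofReal (t ^ (-α)) := fun n => by
    rw [← ENNReal.ofReal_mul (by positivity), expKernel, Real.mul_rpow (by positivity) ht.le,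
      Real.rpow_neg ht.le]
    have : t ^ α ≠ 0 := by positivity
    congr 1
    field_simp
  simp only [e]
  rw [ENNReal.tsum_mul_right]
  gcongr
  exact h t ht

theorem ofReal_rpow_rpow {t : ℝ} (ht : 0 < t) (a : ℝ) {b : ℝ} (hb : 0 < b) :
    ENNReal.ofReal (t ^ a) ^ b = ENNReal.ofReal (t ^ (a * b)) := by
  rw [ENNReal.ofReal_rpow_of_nonneg (by positivity) hb.le, Real.rpow_mul ht.le]

/-- The dyadic samples of the Laplace transform of an `L^p` function. -/
theorem exists_tsum_laplace_le {p p' : ℝ} (hp : p.HolderConjugate p') :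
    ∃ M : ℝ≥0∞, M ≠ ⊤ ∧ ∀ f : ℝ → ℝ≥0∞, Measurable f →
      ∑' n : ℤ, (∫⁻ t in Set.Ioi (0 : ℝ), ENNReal.ofReal (expKernel (1 / p') n t) * f t) ^ p ≤
        M * ∫⁻ t in Set.Ioi (0 : ℝ), f t ^ p := by
  have hp0 := hp.pos
  have hp0' := hp.symm.pos
  have hpp : 1 / p' - 1 = - (1 / p) := by
    have : 1 / p + 1 / p' = 1 := by simpa using hp.inv_add_inv_eq_one
    linarith
  obtain ⟨M, hM, h⟩ := exists_tsum_expKernel_le (α := 1 / p') (by positivity)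
    ((div_le_one hp0').2 hp.symm.lt.le)
  refine ⟨ENNReal.ofReal (2 ^ (1 / p') * Real.Gamma (1 / p')) ^ (p - 1) * M, ?_, fun f hf => ?_⟩
  · exact ENNReal.mul_ne_top (ENNReal.rpow_ne_top_of_nonneg hp.sub_one_pos.le
      ENNReal.ofReal_ne_top) hM
  -- With α = 1/p', the weight h(t) = t^(-1/(pp')) satisfies h^p' = t^(α-1) and h^p = t^(-α). These
  -- are the weights of `lintegral_expKernel` and of the pointwise bound on the dyadic sum.
  · have := lintegral_rpow_le_of_schur (μ := (Measure.count : Measure ℤ))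
      (ν := volume.restrict (Set.Ioi (0 : ℝ))) hp (measurable_uncurry_expKernel (1 / p'))
      (g := fun _ => 1) (h := fun t => ENNReal.ofReal (t ^ (-(1 / (p * p')))))
      measurable_const (by fun_prop)
      (C₁ := ENNReal.ofReal (2 ^ (1 / p') * Real.Gamma (1 / p'))) (C₂ := M) ?_ ?_ ?_ hf
    · simpa only [lintegral_count] using this
    · filter_upwards [ae_restrict_mem measurableSet_Ioi] with t ht
      have : 0 < t := ht
      refine ⟨?_, ENNReal.ofReal_ne_top⟩
      simp only [ne_eq, ENNReal.ofReal_eq_zero, not_le]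
      positivity
    · refine Eventually.of_forall fun n => ?_
      rw [ENNReal.one_rpow, mul_one, ← lintegral_expKernel (by positivity) n]
      refine (setLIntegral_congr_fun measurableSet_Ioi fun t ht => ?_).le
      rw [ofReal_rpow_rpow ht _ hp0', hpp]
      congr 3
      field_simp
    · filter_upwards [ae_restrict_mem measurableSet_Ioi] with t ht
      simp only [ENNReal.one_rpow, mul_one, lintegral_count]
      rw [ofReal_rpow_rpow ht _ hp0]
      convert h t ht using 4
      field_simp

/-- Dyadic sums of exponentials in `L^p`. -/
theorem exists_lintegral_expSum_le {p p' : ℝ} (hp : p.HolderConjugate p') :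
    ∃ M : ℝ≥0∞, M ≠ ⊤ ∧ ∀ c : ℤ → ℝ≥0∞,
      ∫⁻ t in Set.Ioi (0 : ℝ), (∑' n, ENNReal.ofReal (expKernel (1 / p) n t) * c n) ^ p ≤
        M * ∑' n, c n ^ p := by
  have hp0 := hp.pos
  have hp0' := hp.symm.pos
  have hpp : 1 / p - 1 = - (1 / p') := by
    have : 1 / p + 1 / p' = 1 := by simpa using hp.inv_add_inv_eq_one
    linarith
  obtain ⟨M, hM, h⟩ := exists_tsum_expKernel_le (α := 1 / p) (by positivity)
    ((div_le_one hp0).2 hp.lt.le)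
  refine ⟨M ^ (p - 1) * ENNReal.ofReal (2 ^ (1 / p) * Real.Gamma (1 / p)), ?_, fun c => ?_⟩
  · exact ENNReal.mul_ne_top (ENNReal.rpow_ne_top_of_nonneg hp.sub_one_pos.le hM)
      ENNReal.ofReal_ne_top
  -- The transposed situation, with α = 1/p: the same power of t now serves as g, with g^p' = t^(-α)
  -- and g^p = t^(α-1).
  · have := lintegral_rpow_le_of_schur (ν := (Measure.count : Measure ℤ))
      (μ := volume.restrict (Set.Ioi (0 : ℝ))) hp
      (K := fun t n => ENNReal.ofReal (expKernel (1 / p) n t))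
      ((measurable_uncurry_expKernel (1 / p)).comp measurable_swap)
      (h := fun _ => 1) (g := fun t => ENNReal.ofReal (t ^ (-(1 / (p * p')))))
      (by fun_prop) measurable_const (by simp) (C₁ := M)
      (C₂ := ENNReal.ofReal (2 ^ (1 / p) * Real.Gamma (1 / p))) ?_ ?_ (f := c)
      (measurable_of_countable _)
    · simpa only [lintegral_count] using this
    · filter_upwards [ae_restrict_mem measurableSet_Ioi] with t ht
      simp only [ENNReal.one_rpow, mul_one, lintegral_count]
      rw [ofReal_rpow_rpow ht _ hp0']
      convert h t ht using 4
      field_simp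
    · refine Eventually.of_forall fun n => ?_
      rw [ENNReal.one_rpow, mul_one, ← lintegral_expKernel (by positivity) n]
      refine (setLIntegral_congr_fun measurableSet_Ioi fun t ht => ?_).le
      rw [ofReal_rpow_rpow ht _ hp0, hpp]
      congr 3
      field_simp

/-! ### Dyadic convolution, strips and the control measure -/

/-- Dyadic convolution operators are bounded on `ℓ^r`. -/
theorem exists_tsum_dyadic_conv_le {r r' : ℝ} (hr : r.HolderConjugate r') {φ : ℝ → ℝ}
    {a b C : ℝ} (ha : 0 < a) (hb : 0 < b) (hC : 0 ≤ C)
    (h1 : ∀ x, 0 < x → φ x ≤ C * x ^ a) (h2 : ∀ x, 0 < x → φ x ≤ C * x ^ (-b)) :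
    ∃ M : ℝ≥0∞, M ≠ ⊤ ∧ ∀ f : ℤ → ℝ≥0∞,
      ∑' n : ℤ, (∑' m : ℤ, ENNReal.ofReal (φ ((2 : ℝ) ^ n / 2 ^ m)) * f m) ^ r ≤
        M * ∑' m, f m ^ r := by
  -- Row sums, with n fixed and m running, sample x ↦ φ(x⁻¹), for which the two decay rates change
  -- places.
  obtain ⟨M₁, hM₁, H₁⟩ := exists_tsum_dyadic_le (φ := fun x => φ x⁻¹) hb ha hC
    (fun x hx => by
      have := h2 x⁻¹ (inv_pos.2 hx)
      rwa [Real.inv_rpow hx.le, ← Real.rpow_neg hx.le, neg_neg] at this)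
    (fun x hx => by
      have := h1 x⁻¹ (inv_pos.2 hx)
      rwa [Real.inv_rpow hx.le, ← Real.rpow_neg hx.le] at this)
  obtain ⟨M₂, hM₂, H₂⟩ := exists_tsum_dyadic_le ha hb hC h1 h2
  refine ⟨M₁ ^ (r - 1) * M₂, ENNReal.mul_ne_top
    (ENNReal.rpow_ne_top_of_nonneg hr.sub_one_pos.le hM₁) hM₂, fun f => ?_⟩
  refine tsum_rpow_le_of_schur hr _ (fun n => ?_) (fun m => ?_) f
  · convert H₁ ((2 : ℝ) ^ n)⁻¹ (by positivity) using 5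
    rw [mul_inv, inv_inv]; ring
  · exact H₂ ((2 : ℝ) ^ m)⁻¹ (by positivity)

theorem measurableSet_strip (n : ℤ) : MeasurableSet (strip n) :=
  (measurableSet_lt measurable_const Complex.measurable_re).inter
    (measurableSet_le Complex.measurable_re measurable_const)

theorem exists_mem_strip {z : ℂ} (hz : 0 < z.re) : ∃ n, z ∈ strip n := by
  obtain ⟨n, h1, h2⟩ := exists_mem_Ioc_zpow hz (one_lt_two (α := ℝ))
  exact ⟨n + 1, by simpa [strip] using ⟨h1, h2⟩⟩

theorem strip_unique {z : ℂ} {m n : ℤ} (hm : z ∈ strip m) (hn : z ∈ strip n) : m = n := by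
  have key : ∀ {m n : ℤ}, z ∈ strip m → z ∈ strip n → m ≤ n := fun {m n} hm hn => by
    have := (zpow_lt_zpow_iff_right₀ (one_lt_two (α := ℝ))).1 (hm.1.trans_le hn.2)
    omega
  exact le_antisymm (key hm hn) (key hn hm)

/-- On the sector, `|z|` is controlled by `Re z`. -/
theorem cos_mul_norm_le_re {θ : ℝ} (hθ : θ < Real.pi / 2) {z : ℂ} (hz : z ∈ sector θ) :
    Real.cos θ * ‖z‖ ≤ z.re := by
  have h1 : Real.cos θ ≤ Real.cos z.arg := by
    rw [← Real.cos_abs z.arg]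
    exact Real.cos_le_cos_of_nonneg_of_le_pi (abs_nonneg _) (by linarith [Real.pi_pos]) hz.2.le
  calc Real.cos θ * ‖z‖ ≤ Real.cos z.arg * ‖z‖ := by gcongr
    _ = z.re := by rw [mul_comm, Complex.norm_mul_cos_arg]

section control

variable {lam : ℕ → LeftHP} {q : ℝ} [Fact (1 ≤ q)] (B : ℂ →L[ℂ] Extrap lam q)

theorem lintegral_controlMeasure (F : ℂ → ℝ≥0∞) :
    ∫⁻ z, F z ∂controlMeasure lam q B =
      ∑' k, ENNReal.ofReal (‖B 1 k‖ ^ q) * F (-(lam k : ℂ)) := by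
  simp [controlMeasure, lintegral_sum_measure, lintegral_smul_measure, lintegral_dirac]

theorem controlMeasure_strip (n : ℤ) : controlMeasure lam q B (strip n) =
    ∑' k, ENNReal.ofReal (‖B 1 k‖ ^ q) * (strip n).indicator 1 (-(lam k : ℂ)) := by
  rw [← lintegral_controlMeasure, lintegral_indicator_one (measurableSet_strip n)]

theorem re_neg_pos (l : LeftHP) : 0 < (-(l : ℂ)).re := by
  have := l.2
  simpa using this

/-- Each -λ_k lies in some strip, so a sum over k is at most the sum grouped by strips. The reverse
comparison below also needs that the strip is unique. -/
theorem tsum_le_tsum_strip {F : ℕ → ℝ≥0∞} {G : ℤ → ℝ≥0∞}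
    (h : ∀ k n, -(lam k : ℂ) ∈ strip n → F k ≤ G n) :
    ∑' k, ENNReal.ofReal (‖B 1 k‖ ^ q) * F k ≤ ∑' n, controlMeasure lam q B (strip n) * G n := by
  simp only [controlMeasure_strip, ← ENNReal.tsum_mul_right]
  rw [ENNReal.tsum_comm]
  refine ENNReal.tsum_le_tsum fun k => ?_
  obtain ⟨n, hn⟩ := exists_mem_strip (re_neg_pos (lam k))
  refine le_trans ?_ (ENNReal.le_tsum n)
  rw [Set.indicator_of_mem hn, Pi.one_apply, mul_one]
  gcongr
  exact h k n hn

theorem tsum_strip_le_tsum {F : ℕ → ℝ≥0∞} {G : ℤ → ℝ≥0∞}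
    (h : ∀ k n, -(lam k : ℂ) ∈ strip n → G n ≤ F k) :
    ∑' n, controlMeasure lam q B (strip n) * G n ≤ ∑' k, ENNReal.ofReal (‖B 1 k‖ ^ q) * F k := by
  simp only [controlMeasure_strip, ← ENNReal.tsum_mul_right]
  rw [ENNReal.tsum_comm]
  refine ENNReal.tsum_le_tsum fun k => ?_
  obtain ⟨n, hn⟩ := exists_mem_strip (re_neg_pos (lam k))
  rw [tsum_eq_single n fun m hm => ?_]
  · rw [Set.indicator_of_mem hn, Pi.one_apply, mul_one]
    gcongr
    exact h k n hn
  · rw [Set.indicator_of_notMem fun h' => hm (strip_unique h' hn), mul_zero, zero_mul]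

theorem strip_mul_le_tsum {F : ℕ → ℝ≥0∞} (n : ℤ) {c : ℝ≥0∞}
    (h : ∀ k, -(lam k : ℂ) ∈ strip n → c ≤ F k) :
    controlMeasure lam q B (strip n) * c ≤ ∑' k, ENNReal.ofReal (‖B 1 k‖ ^ q) * F k := by
  classical
  refine le_trans ?_ (tsum_strip_le_tsum B (F := F) (G := Pi.single n c) fun k m hm => ?_)
  · simpa using ENNReal.le_tsum (f := fun m => controlMeasure lam q B (strip m) *
      (Pi.single n c : ℤ → ℝ≥0∞) m) n
  · rcases eq_or_ne m n with rfl | hmn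
    · simpa using h k hm
    · simp [hmn]

theorem ofReal_norm_rpow (x : Ellq q) :
    ENNReal.ofReal ‖x‖ ^ q = ∑' k, ENNReal.ofReal (‖x k‖ ^ q) := by
  have hq : 0 < q := lt_of_lt_of_le one_pos Fact.out
  have hq' : (ENNReal.ofReal q).toReal = q := ENNReal.toReal_ofReal hq.le
  have h := lp.norm_rpow_eq_tsum (by rwa [hq']) x
  have hs := (lp.memℓp x).summable (by rwa [hq'])
  rw [hq'] at h hs
  rw [ENNReal.ofReal_rpow_of_nonneg (norm_nonneg _) hq.le, h,
    ENNReal.ofReal_tsum_of_nonneg (fun k => by positivity) hs]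

theorem norm_comp_eq {E : Type*} [NormedAddCommGroup E] [NormedSpace ℂ E] (T : ℂ →L[ℂ] E) :
    ‖T‖ = ‖T 1‖ := by
  rw [← ContinuousLinearMap.norm_toSpanSingleton (𝕜 := ℂ) (T 1)]
  congr 1
  ext
  simp

theorem tsum_resolvent (s : ℝ) (hs : 0 < s) :
    ∑' k, ENNReal.ofReal (‖B 1 k‖ ^ q) * ENNReal.ofReal (‖(s : ℂ) - lam k‖⁻¹ ^ q) =
      ENNReal.ofReal ‖(resolvent lam q s hs).comp B‖ ^ q := by
  rw [norm_comp_eq, ofReal_norm_rpow]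
  refine tsum_congr fun k => ?_
  rw [ContinuousLinearMap.comp_apply, resolvent_apply, norm_div,
    div_eq_mul_inv, Real.mul_rpow (norm_nonneg _) (by positivity), ENNReal.ofReal_mul (by positivity)]

/-- The sequence `2^(-n q / p') μ(S_n)`. -/
def stripWeight (p : ℝ) (n : ℤ) : ℝ≥0∞ :=
  ENNReal.ofReal (((2 : ℝ) ^ n) ^ (-(q / p.conjExponent))) * controlMeasure lam q B (strip n)

theorem controlMeasure_strip_eq (p : ℝ) (n : ℤ) : controlMeasure lam q B (strip n) =
    ENNReal.ofReal (((2 : ℝ) ^ n) ^ (q / p.conjExponent)) * stripWeight B p n := by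
  have h : (0 : ℝ) < (2 : ℝ) ^ n := by positivity
  rw [stripWeight, ← mul_assoc, ← ENNReal.ofReal_mul (by positivity), ← Real.rpow_add h,
    add_neg_cancel, Real.rpow_zero, ENNReal.ofReal_one, one_mul]

theorem stripWeight_memlp_iff {p : ℝ} (hq : 0 < q) (hqp : q < p) :
    ((∀ n : ℤ, controlMeasure lam q B (strip n) < ∞) ∧
        Memℓp (fun n : ℤ => (2 : ℝ) ^ (-(n : ℝ) * q / p.conjExponent) *
            (controlMeasure lam q B).real (strip n)) (ENNReal.ofReal (p / (p - q)))) ↔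
      ∑' n, stripWeight B p n ^ (p / (p - q)) ≠ ⊤ := by
  have hpq : 0 < p - q := by linarith
  have hp : 0 < p := by linarith
  rw [← memlp_toReal_iff (div_pos hp hpq)]
  have e : (fun n : ℤ => (2 : ℝ) ^ (-(n : ℝ) * q / p.conjExponent) *
      (controlMeasure lam q B).real (strip n)) = fun n => (stripWeight B p n).toReal := by
    funext n
    rw [stripWeight, ENNReal.toReal_mul, ENNReal.toReal_ofReal (by positivity),
      ← Real.rpow_intCast, ← Real.rpow_mul two_pos.le, Measure.real]
    congr 2
    ring
  rw [e]
  refine and_congr_left' (forall_congr' fun n => ⟨fun h => ?_, fun h => ?_⟩)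
  · exact ENNReal.mul_ne_top ENNReal.ofReal_ne_top h.ne
  · rw [controlMeasure_strip_eq B p]
    exact ENNReal.mul_lt_top ENNReal.ofReal_lt_top h.lt_top

/-! ### Exponents and the resolvent condition -/

theorem holderConjugate_div_sub {p q : ℝ} (hq : 0 < q) (hqp : q < p) :
    (p / (p - q)).HolderConjugate (p / q) := by
  have hpq : 0 < p - q := by linarith
  have hp : 0 < p := by linarith
  rw [Real.holderConjugate_iff]
  refine ⟨(one_lt_div hpq).2 (by linarith), ?_⟩
  field_simp
  ring

theorem div_conjExponent {p : ℝ} (hp : 1 < p) (q : ℝ) : q / p.conjExponent = q - q / p := by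
  have : p - 1 ≠ 0 := by linarith
  rw [Real.conjExponent]
  field_simp

/-- The q-th power of the n-th term is V_n = 2^(nq/p) Σ_k |b_k|^q |2^n - λ_k|^(-q). It is dominated
by Σ_m φ(2^n/2^m) W_m with φ a multiple of x^(q/p)(1+x)^(-q), which decays at both ends since 0 <
q/p < q. Conversely, strip n alone bounds V_n below by a multiple of W_n; only this half uses the
sector. -/
theorem resolvent_memlp_iff {p θ : ℝ} (hqp : q < p) (hθ₀ : 0 < θ) (hθ₁ : θ < Real.pi / 2)
    (hlam : ∀ k, -(lam k : ℂ) ∈ sector θ) :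
    Memℓp (fun n : ℤ => (2 : ℝ) ^ ((n : ℝ) / p) *
          ‖(resolvent lam q ((2 : ℝ) ^ n) (zpow_pos two_pos n)).comp B‖)
        (ENNReal.ofReal (q * p / (p - q))) ↔
      ∑' n, stripWeight B p n ^ (p / (p - q)) ≠ ⊤ := by
  have hq1 : 1 ≤ q := Fact.out
  have hq : 0 < q := by linarith
  have hpq : 0 < p - q := by linarith
  have hp1 : 1 < p := by linarith
  have hp : 0 < p := by linarith
  set r := p / (p - q) with hrdef
  have hconj := holderConjugate_div_sub hq hqp
  rw [← hrdef] at hconj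
  have hr : 0 < r := hconj.pos
  have hκ : 0 < Real.cos θ := Real.cos_pos_of_mem_Ioo ⟨by linarith, hθ₁⟩
  set V : ℤ → ℝ≥0∞ := fun n => ENNReal.ofReal (((2 : ℝ) ^ n) ^ (q / p)) *
    ∑' k, ENNReal.ofReal (‖B 1 k‖ ^ q) *
      ENNReal.ofReal (‖(((2 : ℝ) ^ n : ℝ) : ℂ) - lam k‖⁻¹ ^ q) with hV
  have step1 : Memℓp (fun n : ℤ => (2 : ℝ) ^ ((n : ℝ) / p) *
          ‖(resolvent lam q ((2 : ℝ) ^ n) (zpow_pos two_pos n)).comp B‖)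
        (ENNReal.ofReal (q * p / (p - q))) ↔ ∑' n, V n ^ r ≠ ⊤ := by
    have hqr : 0 < q * p / (p - q) := by positivity
    have h := memlp_toReal_iff (ι := ℤ) hqr (f := fun n : ℤ => ENNReal.ofReal
      ((2 : ℝ) ^ ((n : ℝ) / p) *
          ‖(resolvent lam q ((2 : ℝ) ^ n) (zpow_pos two_pos n)).comp B‖))
    have e1 : ∀ n : ℤ, (ENNReal.ofReal ((2 : ℝ) ^ ((n : ℝ) / p) *
          ‖(resolvent lam q ((2 : ℝ) ^ n) (zpow_pos two_pos n)).comp B‖)).toReal =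
        (2 : ℝ) ^ ((n : ℝ) / p) *
          ‖(resolvent lam q ((2 : ℝ) ^ n) (zpow_pos two_pos n)).comp B‖ := fun n =>
      ENNReal.toReal_ofReal (by positivity)
    have e2 : ∀ n : ℤ, ENNReal.ofReal ((2 : ℝ) ^ ((n : ℝ) / p) *
          ‖(resolvent lam q ((2 : ℝ) ^ n) (zpow_pos two_pos n)).comp B‖) ^ (q * p / (p - q)) =
        V n ^ r := fun n => by
      rw [mul_div_assoc, ENNReal.rpow_mul, ENNReal.ofReal_mul (by positivity),
        ENNReal.mul_rpow_of_nonneg _ _ hq.le, ← tsum_resolvent,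
        ENNReal.ofReal_rpow_of_nonneg (by positivity) hq.le, hV]
      have e3 : ((2 : ℝ) ^ ((n : ℝ) / p)) ^ q = ((2 : ℝ) ^ n) ^ (q / p) := by
        rw [← Real.rpow_mul two_pos.le, ← Real.rpow_intCast, ← Real.rpow_mul two_pos.le]
        congr 1
        ring
      rw [e3]
    simp only [e1, e2] at h
    rw [← h]
    exact ⟨fun h => ⟨fun _ => ENNReal.ofReal_ne_top, h⟩, fun h => h.2⟩
  rw [step1]
  constructor
  · intro h
    have key : ∀ n, ENNReal.ofReal ((2 / Real.cos θ)⁻¹ ^ q) * stripWeight B p n ≤ V n := fun n => by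
      have hn : (0 : ℝ) < (2 : ℝ) ^ n := by positivity
      have := strip_mul_le_tsum B (F := fun k =>
        ENNReal.ofReal (‖(((2 : ℝ) ^ n : ℝ) : ℂ) - lam k‖⁻¹ ^ q)) n
        (c := ENNReal.ofReal ((2 / Real.cos θ * 2 ^ n)⁻¹ ^ q)) fun k hk => by
          refine ENNReal.ofReal_le_ofReal ?_
          have h0 := sub_ne_zero_of_pos (lam k) hn
          have h1 := cos_mul_norm_le_re hθ₁ (hlam k)
          -- In the sector |λ_k| ≤ 2^n / cos θ on strip n, and cos θ ≤ 1 lets 2^n be absorbed as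
          -- well.
          have h2 : ‖(((2 : ℝ) ^ n : ℝ) : ℂ) - lam k‖ ≤ 2 / Real.cos θ * 2 ^ n := by
            have h3 : ‖(((2 : ℝ) ^ n : ℝ) : ℂ) - lam k‖ ≤ 2 ^ n + ‖-(lam k : ℂ)‖ := by
              rw [sub_eq_add_neg]
              refine (norm_add_le _ _).trans_eq ?_
              rw [Complex.norm_real, Real.norm_of_nonneg hn.le]
            have h4 := hk.2
            have h5 := Real.cos_le_one θ
            rw [div_mul_eq_mul_div, le_div_iff₀ hκ]
            nlinarith
          gcongr
      refine le_trans ?_ (mul_le_mul_right this _)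
      rw [controlMeasure_strip_eq B p]
      have : ENNReal.ofReal ((2 / Real.cos θ)⁻¹ ^ q) =
          ENNReal.ofReal (((2 : ℝ) ^ n) ^ (q / p)) *
          ENNReal.ofReal (((2 : ℝ) ^ n) ^ (q / p.conjExponent)) *
          ENNReal.ofReal ((2 / Real.cos θ * 2 ^ n)⁻¹ ^ q) := by
        rw [← ENNReal.ofReal_mul (by positivity), ← ENNReal.ofReal_mul (by positivity),
          ← Real.rpow_add hn, div_conjExponent hp1, add_sub_cancel,
          ← Real.mul_rpow hn.le (by positivity)]
        congr 2
        field_simp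
      rw [this]
      exact le_of_eq (by ring)
    have hc0 : ENNReal.ofReal ((2 / Real.cos θ)⁻¹ ^ q) ^ r ≠ 0 := by
      refine (ENNReal.rpow_pos ?_ ENNReal.ofReal_ne_top).ne'
      rw [ENNReal.ofReal_pos]
      positivity
    have h2 : ENNReal.ofReal ((2 / Real.cos θ)⁻¹ ^ q) ^ r * ∑' n, stripWeight B p n ^ r ≤
        ∑' n, V n ^ r := by
      rw [← ENNReal.tsum_mul_left]
      refine ENNReal.tsum_le_tsum fun n => ?_
      rw [← ENNReal.mul_rpow_of_nonneg _ _ hr.le]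
      exact ENNReal.rpow_le_rpow (key n) hr.le
    intro ht
    rw [ht, ENNReal.mul_top hc0, top_le_iff] at h2
    exact h h2
  · intro h
    have hα : 0 < q - q / p := by
      have : q / p < q := div_lt_self hq hp1
      linarith
    -- The factor 2^q comes from the lower edge of the strip: Re(-λ_k) > 2^m/2 gives |2^n - λ_k| ≥
    -- (2^n + 2^m)/2.
    obtain ⟨M, hM, H⟩ := exists_tsum_dyadic_conv_le hconj
      (φ := fun x => 2 ^ q * (x ^ (q / p) * (x + 1)⁻¹ ^ q)) (a := q / p) (b := q - q / p)
      (C := 2 ^ q) (by positivity) hα (by positivity)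
      (fun x hx => by
        refine mul_le_mul_of_nonneg_left (mul_le_of_le_one_right (by positivity) ?_)
          (by positivity)
        exact Real.rpow_le_one (by positivity) (inv_le_one_of_one_le₀ (by linarith)) hq.le)
      (fun x hx => by
        refine mul_le_mul_of_nonneg_left ?_ (by positivity)
        rw [neg_sub, Real.rpow_sub hx, div_eq_mul_inv (x ^ (q / p)), ← Real.inv_rpow hx.le]
        gcongr
        linarith)
    refine ne_top_of_le_ne_top (ENNReal.mul_ne_top hM h) (le_trans ?_ (H _))
    refine ENNReal.tsum_le_tsum fun n => ENNReal.rpow_le_rpow ?_ hr.le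
    have hn : (0 : ℝ) < (2 : ℝ) ^ n := by positivity
    have := tsum_le_tsum_strip B (F := fun k =>
        ENNReal.ofReal (‖(((2 : ℝ) ^ n : ℝ) : ℂ) - lam k‖⁻¹ ^ q))
        (G := fun m => ENNReal.ofReal ((((2 : ℝ) ^ n + 2 ^ m) / 2)⁻¹ ^ q)) fun k m hk => by
      refine ENNReal.ofReal_le_ofReal ?_
      have hm : (0 : ℝ) < (2 : ℝ) ^ m := by positivity
      have h1 := Complex.re_le_norm ((((2 : ℝ) ^ n : ℝ) : ℂ) - lam k)
      have h2 := hk.1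
      rw [zpow_sub_one₀ two_ne_zero] at h2
      simp only [Complex.sub_re, Complex.ofReal_re, Complex.neg_re] at h1 h2
      gcongr
      linarith
    refine (mul_le_mul_right this _).trans_eq ?_
    rw [← ENNReal.tsum_mul_left]
    refine tsum_congr fun m => ?_
    have hm : (0 : ℝ) < (2 : ℝ) ^ m := by positivity
    have e : ENNReal.ofReal (2 ^ q * (((2 : ℝ) ^ n / 2 ^ m) ^ (q / p) *
        ((2 : ℝ) ^ n / 2 ^ m + 1)⁻¹ ^ q)) =
        ENNReal.ofReal (((2 : ℝ) ^ n) ^ (q / p)) *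
        (ENNReal.ofReal (((2 : ℝ) ^ m) ^ (q / p.conjExponent)) *
        ENNReal.ofReal ((((2 : ℝ) ^ n + 2 ^ m) / 2)⁻¹ ^ q)) := by
      rw [← ENNReal.ofReal_mul (by positivity), ← ENNReal.ofReal_mul (by positivity)]
      congr 1
      have e1 : ((2 : ℝ) ^ n / 2 ^ m + 1)⁻¹ = (((2 : ℝ) ^ n + 2 ^ m) / 2)⁻¹ * 2⁻¹ * 2 ^ m := by
        field_simp
      rw [e1, Real.mul_rpow (by positivity) hm.le, Real.mul_rpow (by positivity) (by positivity),
        Real.div_rpow hn.le hm.le, div_conjExponent hp1, Real.rpow_sub hm,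
        Real.inv_rpow two_pos.le]
      have : ((2 : ℝ) ^ m) ^ (q / p) ≠ 0 := by positivity
      have : (2 : ℝ) ^ q ≠ 0 := by positivity
      field_simp
    rw [e, controlMeasure_strip_eq B p]
    ring

end control

/-! ### Dyadic shells and the balayage condition -/

/-- The dyadic shell `{t : 2^(n-1) < |t| ≤ 2^n}` of the real line. -/
def shell (n : ℤ) : Set ℝ := {t | (2 : ℝ) ^ (n - 1) < |t| ∧ |t| ≤ (2 : ℝ) ^ n}

theorem ofReal_mem_strip_iff {n : ℤ} {t : ℝ} : ((|t| : ℝ) : ℂ) ∈ strip n ↔ t ∈ shell n := by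
  simp [strip, shell]

theorem measurableSet_shell (n : ℤ) : MeasurableSet (shell n) :=
  (measurableSet_lt measurable_const measurable_id.abs).inter
    (measurableSet_le measurable_id.abs measurable_const)

theorem lintegral_eq_tsum_shell (f : ℝ → ℝ≥0∞) :
    ∫⁻ t, f t = ∑' n, ∫⁻ t in shell n, f t := by
  rw [← lintegral_iUnion measurableSet_shell, ← setLIntegral_univ]
  · refine setLIntegral_congr ?_
    have h : (⋃ n, shell n) = {0}ᶜ := by
      ext t
      simp only [Set.mem_iUnion, Set.mem_compl_iff, Set.mem_singleton_iff]
      constructor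
      · rintro ⟨n, hn⟩ rfl
        have := hn.1
        rw [abs_zero] at this
        exact absurd this (not_lt.2 (by positivity))
      · intro ht
        obtain ⟨n, hn⟩ := exists_mem_strip (z := ((|t| : ℝ) : ℂ)) (by simpa using ht)
        exact ⟨n, ofReal_mem_strip_iff.1 hn⟩
    rw [h]
    exact (ae_eq_univ.2 (by simp)).symm
  · intro m n hmn
    refine Set.disjoint_left.2 fun t hm hn => hmn ?_
    exact strip_unique (ofReal_mem_strip_iff.2 hm) (ofReal_mem_strip_iff.2 hn)

theorem volume_shell_le (n : ℤ) : volume (shell n) ≤ 2 * ENNReal.ofReal ((2 : ℝ) ^ n) := by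
  have h : shell n ⊆ Set.Icc (-(2 : ℝ) ^ n) (2 ^ n) := fun t ht => abs_le.1 ht.2
  refine (measure_mono h).trans_eq ?_
  rw [Real.volume_Icc, sub_neg_eq_add, ENNReal.ofReal_add (by positivity) (by positivity), two_mul]

theorem le_volume_shell (n : ℤ) : ENNReal.ofReal ((2 : ℝ) ^ n) ≤ 2 * volume (shell n) := by
  have h : Set.Ioc ((2 : ℝ) ^ (n - 1)) (2 ^ n) ⊆ shell n := fun t ht => by
    have : 0 < t := lt_trans (by positivity) ht.1
    simpa [shell, abs_of_pos this] using ht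
  refine le_trans (le_of_eq ?_) (mul_le_mul_right (measure_mono h) 2)
  rw [Real.volume_Ioc, ← ENNReal.ofReal_ofNat 2, ← ENNReal.ofReal_mul two_pos.le,
    zpow_sub_one₀ two_ne_zero]
  congr 1
  ring

theorem ofReal_zpow_rpow_neg_inv {r : ℝ} (hr : 0 < r) (n : ℤ) :
    ENNReal.ofReal ((2 : ℝ) ^ n) * ENNReal.ofReal (((2 : ℝ) ^ n) ^ (-(1 / r))) ^ r = 1 := by
  have hn : (0 : ℝ) < (2 : ℝ) ^ n := by positivity
  rw [ofReal_rpow_rpow hn _ hr, ← ENNReal.ofReal_mul hn.le, neg_mul, one_div_mul_cancel hr.ne',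
    Real.rpow_neg_one, mul_inv_cancel₀ hn.ne', ENNReal.ofReal_one]

/-- The factor 2^(-n/r) offsets the length of shell n, comparable to 2^n, so that the shell
contributes about A_n^r. The next lemma is the matching lower bound. -/
theorem lintegral_rpow_le_of_shell {r : ℝ} (hr : 0 < r) {f : ℝ → ℝ≥0∞} {A : ℤ → ℝ≥0∞}
    (h : ∀ n, ∀ t ∈ shell n, f t ≤ ENNReal.ofReal (((2 : ℝ) ^ n) ^ (-(1 / r))) * A n) :
    ∫⁻ t, f t ^ r ≤ 2 * ∑' n, A n ^ r := by
  rw [lintegral_eq_tsum_shell, ← ENNReal.tsum_mul_left]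
  refine ENNReal.tsum_le_tsum fun n => ?_
  calc ∫⁻ t in shell n, f t ^ r
      ≤ ∫⁻ _ in shell n, (ENNReal.ofReal (((2 : ℝ) ^ n) ^ (-(1 / r))) * A n) ^ r :=
        setLIntegral_mono' (measurableSet_shell n) fun t ht =>
          ENNReal.rpow_le_rpow (h n t ht) hr.le
    _ ≤ (ENNReal.ofReal (((2 : ℝ) ^ n) ^ (-(1 / r))) * A n) ^ r *
          (2 * ENNReal.ofReal ((2 : ℝ) ^ n)) := by
        rw [setLIntegral_const]
        gcongr
        exact volume_shell_le n
    _ = 2 * (ENNReal.ofReal ((2 : ℝ) ^ n) *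
          ENNReal.ofReal (((2 : ℝ) ^ n) ^ (-(1 / r))) ^ r) * A n ^ r := by
        rw [ENNReal.mul_rpow_of_nonneg _ _ hr.le]
        ring
    _ = 2 * A n ^ r := by rw [ofReal_zpow_rpow_neg_inv hr, mul_one]

theorem le_lintegral_rpow_of_shell {r : ℝ} (hr : 0 < r) {f : ℝ → ℝ≥0∞} {A : ℤ → ℝ≥0∞}
    (h : ∀ n, ∀ t ∈ shell n, ENNReal.ofReal (((2 : ℝ) ^ n) ^ (-(1 / r))) * A n ≤ f t) :
    ∑' n, A n ^ r ≤ 2 * ∫⁻ t, f t ^ r := by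
  rw [lintegral_eq_tsum_shell, ← ENNReal.tsum_mul_left]
  refine ENNReal.tsum_le_tsum fun n => ?_
  calc A n ^ r = (ENNReal.ofReal ((2 : ℝ) ^ n) *
          ENNReal.ofReal (((2 : ℝ) ^ n) ^ (-(1 / r))) ^ r) * A n ^ r := by
        rw [ofReal_zpow_rpow_neg_inv hr, one_mul]
    _ ≤ 2 * volume (shell n) * ENNReal.ofReal (((2 : ℝ) ^ n) ^ (-(1 / r))) ^ r * A n ^ r := by
        gcongr
        exact le_volume_shell n
    _ = 2 * ∫⁻ _ in shell n, (ENNReal.ofReal (((2 : ℝ) ^ n) ^ (-(1 / r))) * A n) ^ r := by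
        rw [setLIntegral_const, ENNReal.mul_rpow_of_nonneg _ _ hr.le]
        ring
    _ ≤ 2 * ∫⁻ t in shell n, f t ^ r := by
        gcongr 2 * ?_
        exact setLIntegral_mono' (measurableSet_shell n) fun t ht =>
          ENNReal.rpow_le_rpow (h n t ht) hr.le

/-- In the application β = q(2-p)/p, whose sign depends on the side of 2 on which p lies; |β| in the
constant covers both cases. -/
theorem rpow_abs_bounds {n : ℤ} {t : ℝ} (ht : t ∈ shell n) (β : ℝ) :
    |t| ^ β ≤ 2 ^ |β| * ((2 : ℝ) ^ n) ^ β ∧ ((2 : ℝ) ^ n) ^ β ≤ 2 ^ |β| * |t| ^ β := by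
  have hn : (0 : ℝ) < (2 : ℝ) ^ n := by positivity
  obtain ⟨h1, h2⟩ := ht
  rw [zpow_sub_one₀ two_ne_zero] at h1
  have ht0 : 0 < |t| := lt_trans (by positivity) h1
  have h3 : (2 : ℝ) ^ n ≤ 2 * |t| := by linarith
  rcases le_or_gt 0 β with hβ | hβ
  · rw [abs_of_nonneg hβ, ← Real.mul_rpow two_pos.le ht0.le, ← Real.mul_rpow two_pos.le hn.le]
    exact ⟨Real.rpow_le_rpow ht0.le (by linarith) hβ, Real.rpow_le_rpow hn.le h3 hβ⟩
  · rw [abs_of_neg hβ, Real.rpow_neg two_pos.le, ← Real.inv_rpow two_pos.le,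
      ← Real.mul_rpow (by positivity) ht0.le, ← Real.mul_rpow (by positivity) hn.le]
    exact ⟨Real.rpow_le_rpow_of_nonpos (by positivity) (by linarith) hβ.le,
      Real.rpow_le_rpow_of_nonpos (by positivity) (by linarith) hβ.le⟩

/-- In the sector |Im z| ≤ Re z / κ, so Re² + (t - Im)² and Re² + t² agree up to a factor 3/κ².
Replacing Re z and |t| by 2^m and 2^n costs a further 2 in the lower bound and 4 in the upper one,
whence 6 and 12. -/
theorem poissonRHP_bounds {κ : ℝ} (hκ : 0 < κ) (hκ1 : κ ≤ 1) {z : ℂ} (hz : κ * ‖z‖ ≤ z.re)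
    {m : ℤ} (hm : z ∈ strip m) {n : ℤ} {t : ℝ} (ht : t ∈ shell n) :
    κ ^ 2 / (6 * Real.pi) * ((2 : ℝ) ^ m / ((2 ^ m) ^ 2 + (2 ^ n) ^ 2)) ≤ poissonRHP z t ∧
    poissonRHP z t ≤ 12 / (Real.pi * κ ^ 2) * ((2 : ℝ) ^ m / ((2 ^ m) ^ 2 + (2 ^ n) ^ 2)) := by
  have hπ := Real.pi_pos
  obtain ⟨hx1, hx2⟩ := hm
  obtain ⟨ht1, ht2⟩ := ht
  rw [zpow_sub_one₀ two_ne_zero] at hx1 ht1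
  have hY : (0 : ℝ) < 2 ^ m := by positivity
  have hX : (0 : ℝ) < 2 ^ n := by positivity
  set Y : ℝ := 2 ^ m
  set X : ℝ := 2 ^ n
  have hx0 : 0 < z.re := lt_trans (by positivity) hx1
  have hy : κ ^ 2 * z.im ^ 2 ≤ z.re ^ 2 := by
    rw [← mul_pow, ← sq_abs (κ * z.im), abs_mul, abs_of_pos hκ]
    refine pow_le_pow_left₀ (by positivity) (le_trans ?_ hz) 2
    gcongr
    exact Complex.abs_im_le_norm z
  have htX : t ^ 2 ≤ X ^ 2 := by
    rw [← sq_abs t]; exact pow_le_pow_left₀ (abs_nonneg _) ht2 2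
  have hXt : X ^ 2 ≤ 4 * t ^ 2 := by
    rw [← sq_abs t]
    nlinarith
  have hκ2 : κ ^ 2 ≤ 1 := by nlinarith
  set y := z.im
  set x := z.re
  have ht2' := mul_nonneg (sub_nonneg.2 hκ2) (sq_nonneg t)
  have hty2 := mul_nonneg (sub_nonneg.2 hκ2) (sq_nonneg (t - y))
  have hx2' := mul_nonneg (sub_nonneg.2 hκ2) (sq_nonneg x)
  -- Parallelogram identities, giving (t-y)² ≤ 2t² + 2y² and t² ≤ 2(t-y)² + 2y²; the factor κ²
  -- allows y² to be replaced by x².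
  have e1 : κ ^ 2 * (t - y) ^ 2 + κ ^ 2 * (t + y) ^ 2 = 2 * κ ^ 2 * t ^ 2 + 2 * (κ ^ 2 * y ^ 2) := by
    ring
  have e1' : 0 ≤ κ ^ 2 * (t + y) ^ 2 := by positivity
  have e2 : κ ^ 2 * t ^ 2 + κ ^ 2 * (t - 2 * y) ^ 2 =
      2 * κ ^ 2 * (t - y) ^ 2 + 2 * (κ ^ 2 * y ^ 2) := by ring
  have e2' : 0 ≤ κ ^ 2 * (t - 2 * y) ^ 2 := by positivity
  have d1 : κ ^ 2 * (x ^ 2 + (t - y) ^ 2) ≤ 3 * (x ^ 2 + t ^ 2) := by nlinarith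
  have d2 : κ ^ 2 * (x ^ 2 + t ^ 2) ≤ 3 * (x ^ 2 + (t - y) ^ 2) := by nlinarith
  have hxY : x ^ 2 ≤ Y ^ 2 := by nlinarith
  have hYx : Y ^ 2 ≤ 4 * x ^ 2 := by nlinarith
  have hD : 0 < x ^ 2 + (t - y) ^ 2 := by positivity
  have hE : 0 < Y ^ 2 + X ^ 2 := by positivity
  rw [poissonRHP]
  constructor
  · rw [div_mul_div_comm, one_div, ← div_eq_inv_mul, div_div,
      div_le_div_iff₀ (by positivity) (by positivity)]
    have h1 : κ ^ 2 * (x ^ 2 + (t - y) ^ 2) ≤ 3 * (Y ^ 2 + X ^ 2) := by linarith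
    have h2 := mul_le_mul_of_nonneg_left h1 hY.le
    have h3 : Y * (3 * (Y ^ 2 + X ^ 2)) ≤ 2 * x * (3 * (Y ^ 2 + X ^ 2)) := by
      gcongr
      linarith
    have h4 := mul_le_mul_of_nonneg_left (h2.trans h3) hπ.le
    nlinarith
  · rw [div_mul_div_comm, one_mul, div_mul_div_comm,
      div_le_div_iff₀ (by positivity) (by positivity)]
    have h1 : κ ^ 2 * (Y ^ 2 + X ^ 2) ≤ 12 * (x ^ 2 + (t - y) ^ 2) := by nlinarith
    have h2 := mul_le_mul_of_nonneg_left h1 hx0.le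
    have h3 : x * (12 * (x ^ 2 + (t - y) ^ 2)) ≤ Y * (12 * (x ^ 2 + (t - y) ^ 2)) := by
      gcongr
    have h4 := mul_le_mul_of_nonneg_left (h2.trans h3) hπ.le
    nlinarith

section control

variable {lam : ℕ → LeftHP} {q : ℝ} [Fact (1 ≤ q)] (B : ℂ →L[ℂ] Extrap lam q)

theorem balayage_controlMeasure (t : ℝ) : balayage (controlMeasure lam q B) t =
    ∑' k, ENNReal.ofReal (‖B 1 k‖ ^ q) * ENNReal.ofReal (poissonRHP (-(lam k : ℂ)) t) := by
  have hm : MeasurableSet {z : ℂ | 0 < z.re} :=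
    measurableSet_lt measurable_const Complex.measurable_re
  rw [balayage, ← lintegral_indicator hm, lintegral_controlMeasure]
  refine tsum_congr fun k => ?_
  rw [Set.indicator_of_mem]
  exact re_neg_pos (lam k)

theorem measurable_balayage_controlMeasure : Measurable (balayage (controlMeasure lam q B)) := by
  have : balayage (controlMeasure lam q B) = fun t =>
      ∑' k, ENNReal.ofReal (‖B 1 k‖ ^ q) * ENNReal.ofReal (poissonRHP (-(lam k : ℂ)) t) :=
    funext (balayage_controlMeasure B)
  rw [this]
  unfold poissonRHP
  fun_prop

/-- On shell n the weighted balayage is at most 2^(-n/r) Σ_m φ(2^n/2^m) W_m with φ a multiple of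
x^(1-α)/(1+x²), α = q/p'. It decays at ∞ like x^(-1-α), and at 0 because α < 1. The strip m = n
gives the lower bound. -/
theorem balayage_memLp_iff {p θ : ℝ} (hqp : q < p) (hθ₀ : 0 < θ) (hθ₁ : θ < Real.pi / 2)
    (hlam : ∀ k, -(lam k : ℂ) ∈ sector θ) (hqp' : q < p.conjExponent) :
    MemLp (fun t : ℝ => ENNReal.ofReal (|t| ^ (q * (2 - p) / p)) *
        balayage (controlMeasure lam q B) t) (ENNReal.ofReal (p / (p - q))) volume ↔
      ∑' n, stripWeight B p n ^ (p / (p - q)) ≠ ⊤ := by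
  have hq1 : 1 ≤ q := Fact.out
  have hq : 0 < q := by linarith
  have hpq : 0 < p - q := by linarith
  have hp1 : 1 < p := by linarith
  have hp : 0 < p := by linarith
  have hconj := holderConjugate_div_sub hq hqp
  have hrinv : 1 / (p / (p - q)) = 1 - q / p := by field_simp
  set r := p / (p - q) with hrdef
  have hr : 0 < r := hconj.pos
  have hκ : 0 < Real.cos θ := Real.cos_pos_of_mem_Ioo ⟨by linarith, hθ₁⟩
  have hκ1 := Real.cos_le_one θ
  set κ := Real.cos θ
  have hπ := Real.pi_pos
  set β := q * (2 - p) / p with hβ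
  set α := q / p.conjExponent with hα
  -- The weight exponent splits into the normalisation -1/r of a shell and the power 1-α that makes
  -- the kernel depend on 2^n/2^m only.
  have hαβ : β = -(1 / r) + (1 - α) := by
    rw [hrinv, hα, div_conjExponent hp1, hβ]
    field_simp
    ring
  have hα1 : α < 1 := by
    rw [hα, div_lt_one (by linarith)]
    exact hqp'
  have hα0 : 0 ≤ α := by
    have : 0 < p - 1 := by linarith
    rw [hα, Real.conjExponent]; positivity
  set f : ℝ → ℝ≥0∞ := fun t => ENNReal.ofReal (|t| ^ β) * balayage (controlMeasure lam q B) t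
    with hf
  have hfm : Measurable f :=
    Measurable.mul (by fun_prop) (measurable_balayage_controlMeasure B)
  have step1 : MemLp f (ENNReal.ofReal r) volume ↔ ∫⁻ t, f t ^ r ≠ ⊤ := by
    rw [MemLp, and_iff_right hfm.aestronglyMeasurable,
      eLpNorm_lt_top_iff_lintegral_rpow_enorm_lt_top (by simpa using hr) ENNReal.ofReal_ne_top,
      ENNReal.toReal_ofReal hr.le, lt_top_iff_ne_top]
    simp only [enorm_eq_self]
  rw [step1]
  constructor
  · intro h ht
    set c : ℝ := (2 ^ |β|)⁻¹ * (κ ^ 2 / (6 * Real.pi)) / 2 with hc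
    have hc0 : 0 < c := by positivity
    have key := le_lintegral_rpow_of_shell hr (f := f)
      (A := fun n => ENNReal.ofReal c * stripWeight B p n) fun n t ht => by
        have hn : (0 : ℝ) < (2 : ℝ) ^ n := by positivity
        have h1 := strip_mul_le_tsum B (F := fun k =>
          ENNReal.ofReal (poissonRHP (-(lam k : ℂ)) t)) n (fun k hk => ENNReal.ofReal_le_ofReal
            (poissonRHP_bounds hκ hκ1 (cos_mul_norm_le_re hθ₁ (hlam k)) hk ht).1)
        rw [← balayage_controlMeasure] at h1
        have h2 : (2 ^ |β|)⁻¹ * ((2 : ℝ) ^ n) ^ β ≤ |t| ^ β := by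
          rw [inv_mul_le_iff₀ (by positivity)]
          exact (rpow_abs_bounds ht β).2
        refine le_trans (le_of_eq ?_) (mul_le_mul' (ENNReal.ofReal_le_ofReal h2) h1)
        rw [controlMeasure_strip_eq B p, ← hα]
        have e : ENNReal.ofReal (((2 : ℝ) ^ n) ^ (-(1 / r))) * ENNReal.ofReal c =
            ENNReal.ofReal ((2 ^ |β|)⁻¹ * ((2 : ℝ) ^ n) ^ β) *
            (ENNReal.ofReal (((2 : ℝ) ^ n) ^ α) *
            ENNReal.ofReal (κ ^ 2 / (6 * Real.pi) *
              ((2 : ℝ) ^ n / ((2 ^ n) ^ 2 + (2 ^ n) ^ 2)))) := by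
          rw [← ENNReal.ofReal_mul (by positivity), ← ENNReal.ofReal_mul (by positivity),
            ← ENNReal.ofReal_mul (by positivity)]
          congr 1
          rw [hαβ, Real.rpow_add hn, Real.rpow_sub hn, Real.rpow_one, hc, ← hαβ]
          have : ((2 : ℝ) ^ n) ^ α ≠ 0 := by positivity
          field_simp
          ring
        rw [← mul_assoc, e]
        ring
    simp only [ENNReal.mul_rpow_of_nonneg _ _ hr.le] at key
    rw [ENNReal.tsum_mul_left, ht, ENNReal.mul_top, top_le_iff] at key
    · exact ENNReal.mul_ne_top ENNReal.ofNat_ne_top h key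
    · exact (ENNReal.rpow_pos (by simpa using hc0) ENNReal.ofReal_ne_top).ne'
  · intro h
    set C : ℝ := 2 ^ |β| * (12 / (Real.pi * κ ^ 2)) with hC
    have hC0 : 0 < C := by positivity
    obtain ⟨M, hM, H⟩ := exists_tsum_dyadic_conv_le hconj
      (φ := fun x => C * (x ^ (1 - α) / (1 + x ^ 2))) (a := 1 - α) (b := 1 + α)
      (C := C) (by linarith) (by linarith) hC0.le
      (fun x hx => by
        refine mul_le_mul_of_nonneg_left (div_le_self (by positivity) ?_) hC0.le
        nlinarith)
      (fun x hx => by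
        refine mul_le_mul_of_nonneg_left ?_ hC0.le
        have : -(1 + α) = (1 - α) - 2 := by ring
        rw [this, Real.rpow_sub hx _ 2, Real.rpow_two]
        gcongr
        linarith)
    refine ne_top_of_le_ne_top (ENNReal.mul_ne_top ENNReal.ofNat_ne_top
      (ENNReal.mul_ne_top hM h)) ((lintegral_rpow_le_of_shell hr (A := fun n => ∑' m : ℤ,
        ENNReal.ofReal (C * (((2 : ℝ) ^ n / 2 ^ m) ^ (1 - α) / (1 + ((2 : ℝ) ^ n / 2 ^ m) ^ 2))) *
          stripWeight B p m) fun n t ht => ?_).trans (mul_le_mul_right (H _) 2))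
    have hn : (0 : ℝ) < (2 : ℝ) ^ n := by positivity
    have h1 := tsum_le_tsum_strip B (F := fun k =>
      ENNReal.ofReal (poissonRHP (-(lam k : ℂ)) t)) (fun k m hk => ENNReal.ofReal_le_ofReal
        (poissonRHP_bounds hκ hκ1 (cos_mul_norm_le_re hθ₁ (hlam k)) hk ht).2)
    rw [← balayage_controlMeasure] at h1
    refine (mul_le_mul' (ENNReal.ofReal_le_ofReal (rpow_abs_bounds ht β).1) h1).trans_eq ?_
    rw [← ENNReal.tsum_mul_left, ← ENNReal.tsum_mul_left]
    refine tsum_congr fun m => ?_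
    have hm : (0 : ℝ) < (2 : ℝ) ^ m := by positivity
    rw [controlMeasure_strip_eq B p, ← hα]
    have e : ENNReal.ofReal (((2 : ℝ) ^ n) ^ (-(1 / r))) *
        ENNReal.ofReal (C * (((2 : ℝ) ^ n / 2 ^ m) ^ (1 - α) / (1 + ((2 : ℝ) ^ n / 2 ^ m) ^ 2))) =
        ENNReal.ofReal (2 ^ |β| * ((2 : ℝ) ^ n) ^ β) *
        (ENNReal.ofReal (((2 : ℝ) ^ m) ^ α) *
        ENNReal.ofReal (12 / (Real.pi * κ ^ 2) *
          ((2 : ℝ) ^ m / ((2 ^ m) ^ 2 + (2 ^ n) ^ 2)))) := by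
      rw [← ENNReal.ofReal_mul (by positivity), ← ENNReal.ofReal_mul (by positivity),
        ← ENNReal.ofReal_mul (by positivity)]
      congr 1
      have e1 : ((2 : ℝ) ^ n) ^ β = ((2 : ℝ) ^ n) ^ (-(1 / r)) * ((2 : ℝ) ^ n) ^ (1 - α) := by
        rw [hαβ, Real.rpow_add hn]
      have e2 : ((2 : ℝ) ^ m) ^ (1 - α) = 2 ^ m / ((2 : ℝ) ^ m) ^ α := by
        rw [Real.rpow_sub hm, Real.rpow_one]
      rw [e1, Real.div_rpow hn.le hm.le, e2, hC]
      have : ((2 : ℝ) ^ m) ^ α ≠ 0 := by positivity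
      field_simp
    rw [← mul_assoc (ENNReal.ofReal (((2 : ℝ) ^ n) ^ (-(1 / r)))), e]
    ring

end control

/-! ### The strip condition implies admissibility -/

/-- The `k`-th coordinate functional of the extrapolation space. -/
def Extrap.coord (lam : ℕ → LeftHP) (q : ℝ) [Fact (1 ≤ q)] (k : ℕ) : Extrap lam q →L[ℂ] ℂ :=
  (1 - (lam k : ℂ)) • (lp.evalCLM ℂ (fun _ : ℕ => ℂ) (ENNReal.ofReal q) k).comp
    (Extrap.resOneIso lam q).toContinuousLinearEquiv.toContinuousLinearMap

section control

variable {lam : ℕ → LeftHP} {q : ℝ} [Fact (1 ≤ q)]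

@[simp] theorem Extrap.coord_apply (k : ℕ) (x : Extrap lam q) :
    Extrap.coord lam q k x = x k := by
  change (1 - (lam k : ℂ)) * (x k / (1 - (lam k : ℂ))) = x k
  exact mul_div_cancel₀ _ (one_sub_ne_zero (lam k))

theorem norm_semigroup_apply_le (t : ℝ≥0) (x : Extrap lam q) : ‖semigroup lam q t x‖ ≤ ‖x‖ := by
  have h0 : ENNReal.ofReal q ≠ 0 :=
    (lt_of_lt_of_le one_pos (Fact.out : 1 ≤ ENNReal.ofReal q)).ne'
  rw [← (Extrap.resOneIso lam q).norm_map, ← (Extrap.resOneIso lam q).norm_map x]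
  refine lp.norm_mono h0 fun k => ?_
  rw [Extrap.resOneIso_apply, Extrap.resOneIso_apply, semigroup_apply, mul_div_assoc, norm_mul]
  refine mul_le_of_le_one_left (norm_nonneg _) ?_
  rw [Complex.norm_exp, Complex.re_mul_ofReal, Real.exp_le_one_iff]
  exact mul_nonpos_of_nonpos_of_nonneg (lam k).2.le t.2

/-- Truncation to finitely many coordinates gives continuous functions of t that converge pointwise,
as q is finite. -/
theorem stronglyMeasurable_semigroup (x : Extrap lam q) :
    StronglyMeasurable fun t : ℝ => semigroup lam q t.toNNReal x := by
  have h : StronglyMeasurable fun t : ℝ =>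
      Extrap.resOneIso lam q (semigroup lam q t.toNNReal x) := by
    refine stronglyMeasurable_of_tendsto atTop (f := fun (N : ℕ) (t : ℝ) =>
      ∑ i ∈ Finset.range N, lp.single (ENNReal.ofReal q) i
        (Extrap.resOneIso lam q (semigroup lam q t.toNNReal x) i)) (fun N => ?_) ?_
    · refine Finset.stronglyMeasurable_fun_sum _ fun i _ => ?_
      refine (lp.isometry_single i).continuous.comp_stronglyMeasurable ?_
      simp only [Extrap.resOneIso_apply, semigroup_apply]
      refine Continuous.stronglyMeasurable ?_
      fun_prop
    · exact tendsto_pi_nhds.2 fun t =>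
        (lp.hasSum_single ENNReal.ofReal_ne_top _).tendsto_sum_nat
  have := (Extrap.resOneIso lam q).symm.continuous.comp_stronglyMeasurable h
  simpa using this

variable (B : ℂ →L[ℂ] Extrap lam q)

theorem map_eq_smul_one (z : ℂ) : B z = z • B 1 := by
  rw [← map_smul, smul_eq_mul, mul_one]

theorem intervalIntegrable_semigroup {p : ℝ} (hp : 1 ≤ p) {u : ℝ → ℂ}
    (hu : MemLp u (ENNReal.ofReal p) (volume.restrict (Set.Ioi 0))) {τ : ℝ} (hτ : 0 < τ) :
    IntervalIntegrable (fun t => semigroup lam q t.toNNReal (B (u t))) volume 0 τ := by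
  rw [intervalIntegrable_iff_integrableOn_Ioc_of_le hτ.le]
  have hu1 : IntegrableOn u (Set.Ioc 0 τ) :=
    (hu.mono_measure (Measure.restrict_mono Set.Ioc_subset_Ioi_self le_rfl)).integrable
      (by simpa using ENNReal.ofReal_le_ofReal hp)
  have e : (fun t => semigroup lam q t.toNNReal (B (u t))) =
      fun t => u t • semigroup lam q t.toNNReal (B 1) := by
    funext t
    rw [map_eq_smul_one, map_smul]
  rw [e]
  refine (hu1.norm.mul_const ‖B 1‖).mono'
    (hu1.1.smul (stronglyMeasurable_semigroup (B 1)).aestronglyMeasurable) ?_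
  refine Eventually.of_forall fun t => ?_
  rw [norm_smul]
  exact mul_le_mul_of_nonneg_left (norm_semigroup_apply_le _ _) (norm_nonneg _)

theorem intervalIntegral_semigroup_apply {u : ℝ → ℂ} {τ : ℝ} (hτ : 0 < τ)
    (hi : IntervalIntegrable (fun t => semigroup lam q t.toNNReal (B (u t))) volume 0 τ) (k : ℕ) :
    (∫ t in (0 : ℝ)..τ, semigroup lam q t.toNNReal (B (u t))) k =
      B 1 k * ∫ t in (0 : ℝ)..τ, Complex.exp (lam k * t) * u t := by
  rw [← Extrap.coord_apply, ← ContinuousLinearMap.intervalIntegral_comp_comm _ hi,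
    ← intervalIntegral.integral_const_mul]
  refine intervalIntegral.integral_congr fun t ht => ?_
  rw [Set.uIcc_of_le hτ.le] at ht
  have hB : B (u t) k = u t * B 1 k := by
    rw [map_eq_smul_one]
    rfl
  simp only [Extrap.coord_apply, semigroup_apply, Real.coe_toNNReal t ht.1, hB]
  ring

theorem exists_ellq_of_tsum_le {x : ℕ → ℂ} {N : ℝ≥0∞} (hN : N ≠ ⊤)
    (h : ∑' k, ENNReal.ofReal (‖x k‖ ^ q) ≤ N ^ q) :
    ∃ y : Ellq q, (∀ k, y k = x k) ∧ ‖y‖ ≤ N.toReal := by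
  have hq : 0 < q := lt_of_lt_of_le one_pos Fact.out
  have hq' : (ENNReal.ofReal q).toReal = q := ENNReal.toReal_ofReal hq.le
  have hfin : ∑' k, ENNReal.ofReal (‖x k‖ ^ q) ≠ ⊤ :=
    ne_top_of_le_ne_top (ENNReal.rpow_ne_top_of_nonneg hq.le hN) h
  have hx : Memℓp x (ENNReal.ofReal q) := by
    rw [memℓp_gen_iff (by rwa [hq']), hq']
    refine (ENNReal.summable_toReal hfin).congr fun k => ?_
    rw [ENNReal.toReal_ofReal (by positivity)]
  refine ⟨⟨x, hx⟩, fun _ => rfl, ?_⟩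
  have h2 := ofReal_norm_rpow (⟨x, hx⟩ : Ellq q)
  rw [← ENNReal.ofReal_le_iff_le_toReal hN, ← ENNReal.rpow_le_rpow_iff hq, h2]
  exact h

/-- The weighted Carleson embedding, for the absolute Laplace transform. -/
theorem exists_tsum_laplace_eigenvalue_le {p : ℝ} (hqp : q < p)
    (h : ∑' n, stripWeight B p n ^ (p / (p - q)) ≠ ⊤) :
    ∃ K : ℝ≥0∞, K ≠ ⊤ ∧ ∀ u : ℝ → ℂ, AEStronglyMeasurable u (volume.restrict (Set.Ioi 0)) →
      ∑' k, ENNReal.ofReal (‖B 1 k‖ ^ q) *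
          (∫⁻ t in Set.Ioi (0 : ℝ), ‖Complex.exp (lam k * t) * u t‖ₑ) ^ q ≤
        (K * eLpNorm u (ENNReal.ofReal p) (volume.restrict (Set.Ioi 0))) ^ q ∧
      (eLpNorm u (ENNReal.ofReal p) (volume.restrict (Set.Ioi 0)) ≠ ⊤ → ∀ k,
        ∫⁻ t in Set.Ioi (0 : ℝ), ‖Complex.exp (lam k * t) * u t‖ₑ ≠ ⊤) := by
  have hq1 : 1 ≤ q := Fact.out
  have hq : 0 < q := by linarith
  have hp1 : 1 < p := by linarith
  have hp : 0 < p := by linarith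
  have hconj := holderConjugate_div_sub hq hqp
  have hpp : p.HolderConjugate p.conjExponent := Real.HolderConjugate.conjExponent hp1
  obtain ⟨M, hM, H⟩ := exists_tsum_laplace_le hpp
  set r := p / (p - q)
  set p' := p.conjExponent with hp'
  have hr : 0 < r := hconj.pos
  have hp'0 : 0 < p' := hpp.symm.pos
  refine ⟨((∑' n, stripWeight B p n ^ r) ^ (1 / r)) ^ (1 / q) * M ^ (1 / p), ENNReal.mul_ne_top
    (ENNReal.rpow_ne_top_of_nonneg (by positivity)
      (ENNReal.rpow_ne_top_of_nonneg (by positivity) h))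
    (ENNReal.rpow_ne_top_of_nonneg (by positivity) hM), fun u hu => ?_⟩
  set I : ℤ → ℝ≥0∞ := fun n =>
    ∫⁻ t in Set.Ioi (0 : ℝ), ENNReal.ofReal (expKernel (1 / p') n t) * ‖u t‖ₑ with hI
  set E := eLpNorm u (ENNReal.ofReal p) (volume.restrict (Set.Ioi 0)) with hE
  have hEp : ∫⁻ t in Set.Ioi (0 : ℝ), ‖u t‖ₑ ^ p = E ^ p := by
    rw [hE, eLpNorm_eq_lintegral_rpow_enorm_toReal (by simpa using hp) ENNReal.ofReal_ne_top,
      ENNReal.toReal_ofReal hp.le, ← ENNReal.rpow_mul, one_div_mul_cancel hp.ne', ENNReal.rpow_one]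
  have HI : ∑' n, I n ^ p ≤ M * E ^ p := by
    have hm := hu.enorm
    have e1 : ∀ n, I n = ∫⁻ t in Set.Ioi (0 : ℝ),
        ENNReal.ofReal (expKernel (1 / p') n t) * hm.mk _ t := fun n => lintegral_congr_ae <| by
      filter_upwards [hm.ae_eq_mk] with t ht
      rw [ht]
    have e2 : ∫⁻ t in Set.Ioi (0 : ℝ), ‖u t‖ₑ ^ p = ∫⁻ t in Set.Ioi (0 : ℝ), hm.mk _ t ^ p :=
      lintegral_congr_ae <| by
        filter_upwards [hm.ae_eq_mk] with t ht
        rw [ht]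
    simp only [e1]
    rw [← hEp, e2]
    exact H _ hm.measurable_mk
  -- On strip n, Re(-λ_k) > 2^(n-1); this is the reason for the rate 2^n/2 in `expKernel`.
  have hJ : ∀ k n, -(lam k : ℂ) ∈ strip n →
      ∫⁻ t in Set.Ioi (0 : ℝ), ‖Complex.exp (lam k * t) * u t‖ₑ ≤
        ENNReal.ofReal (((2 : ℝ) ^ n) ^ (-(1 / p'))) * I n := fun k n hk => by
    have hn : (0 : ℝ) < (2 : ℝ) ^ n := by positivity
    rw [hI, ← lintegral_const_mul' _ _ ENNReal.ofReal_ne_top]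
    refine setLIntegral_mono' measurableSet_Ioi fun t ht => ?_
    rw [enorm_mul, ← mul_assoc, ← ENNReal.ofReal_mul (by positivity)]
    gcongr
    rw [← ofReal_norm, Complex.norm_exp, Complex.re_mul_ofReal]
    refine ENNReal.ofReal_le_ofReal ?_
    rw [expKernel, ← mul_assoc, ← Real.rpow_add hn, neg_add_cancel, Real.rpow_zero, one_mul]
    refine Real.exp_le_exp.2 ?_
    have h1 := hk.1
    rw [zpow_sub_one₀ two_ne_zero] at h1
    simp only [Complex.neg_re] at h1
    have ht' : (0 : ℝ) < t := ht
    nlinarith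
  constructor
  · have h1 := tsum_le_tsum_strip B
      (F := fun k => (∫⁻ t in Set.Ioi (0 : ℝ), ‖Complex.exp (lam k * t) * u t‖ₑ) ^ q)
      (G := fun n => (ENNReal.ofReal (((2 : ℝ) ^ n) ^ (-(1 / p'))) * I n) ^ q)
      fun k n hk => ENNReal.rpow_le_rpow (hJ k n hk) hq.le
    have h2 : ∀ n, controlMeasure lam q B (strip n) *
        (ENNReal.ofReal (((2 : ℝ) ^ n) ^ (-(1 / p'))) * I n) ^ q = stripWeight B p n * I n ^ q :=
      fun n => by
      rw [ENNReal.mul_rpow_of_nonneg _ _ hq.le, ofReal_rpow_rpow (by positivity) _ hq, stripWeight,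
        ← hp', show -(1 / p') * q = -(q / p') by ring]
      ring
    simp only [h2] at h1
    -- Hölder with exponents p/(p-q) and p/q, the latter turning I_n^q into the I_n^p controlled by
    -- `HI`.
    have h3 := tsum_mul_le_Lp_mul_Lq hconj (stripWeight B p) fun n => I n ^ q
    have h4 : ∀ n, (I n ^ q) ^ (p / q) = I n ^ p := fun n => by
      rw [← ENNReal.rpow_mul, mul_div_cancel₀ _ hq.ne']
    simp only [h4] at h3
    refine (h1.trans h3).trans ?_
    calc (∑' n, stripWeight B p n ^ r) ^ (1 / r) * (∑' n, I n ^ p) ^ (1 / (p / q))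
        ≤ (∑' n, stripWeight B p n ^ r) ^ (1 / r) * (M * E ^ p) ^ (1 / (p / q)) := by gcongr
      _ = _ := by
        rw [ENNReal.mul_rpow_of_nonneg _ _ hq.le, ENNReal.mul_rpow_of_nonneg _ _ hq.le,
          ← ENNReal.rpow_mul _ (1 / q), one_div_mul_cancel hq.ne', ENNReal.rpow_one,
          ENNReal.mul_rpow_of_nonneg _ _ (by positivity), ← ENNReal.rpow_mul, ← ENNReal.rpow_mul,
          mul_assoc]
        congr 3
        · field_simp
        · field_simp
  · intro hE' k
    obtain ⟨n, hn⟩ := exists_mem_strip (re_neg_pos (lam k))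
    refine ne_top_of_le_ne_top (ENNReal.mul_ne_top ENNReal.ofReal_ne_top ?_) (hJ k n hn)
    have h5 : I n ^ p ≠ ⊤ := ne_top_of_le_ne_top
      (ENNReal.mul_ne_top hM (ENNReal.rpow_ne_top_of_nonneg hp.le hE'))
      ((ENNReal.le_tsum n).trans HI)
    intro h6
    rw [h6, ENNReal.top_rpow_of_pos hp] at h5
    exact h5 rfl

/-- The limit x has coordinates b_k times the full Laplace transform, and lies in ℓ^q by the
embedding. The same estimate applied to the tail of u beyond τ bounds the difference between x and
the integral up to τ, already in ℓ^q, by the L^p norm of the tail, which tends to 0. -/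
theorem isAdmissible_of_tsum_stripWeight {p : ℝ} (hqp : q < p)
    (h : ∑' n, stripWeight B p n ^ (p / (p - q)) ≠ ⊤) : IsAdmissible lam q p B := by
  have hq1 : 1 ≤ q := Fact.out
  have hq : 0 < q := by linarith
  have hp1 : 1 < p := by linarith
  have hp : 0 < p := by linarith
  obtain ⟨K, hK, H⟩ := exists_tsum_laplace_eigenvalue_le B hqp h
  have key : ∀ u : ℝ → ℂ, MemLp u (ENNReal.ofReal p) (volume.restrict (Set.Ioi 0)) →
      ∃ x : Ellq q, (∀ k, x k = B 1 k * ∫ t in Set.Ioi (0 : ℝ), Complex.exp (lam k * t) * u t) ∧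
        ‖x‖ ≤ K.toReal *
          (eLpNorm u (ENNReal.ofReal p) (volume.restrict (Set.Ioi 0))).toReal := fun u hu => by
    rw [← ENNReal.toReal_mul]
    refine exists_ellq_of_tsum_le (ENNReal.mul_ne_top hK hu.2.ne) (le_trans ?_ (H u hu.1).1)
    refine ENNReal.tsum_le_tsum fun k => ?_
    rw [norm_mul, Real.mul_rpow (norm_nonneg _) (norm_nonneg _),
      ENNReal.ofReal_mul (by positivity)]
    gcongr
    rw [← ENNReal.ofReal_rpow_of_nonneg (norm_nonneg _) hq.le, ofReal_norm]
    exact ENNReal.rpow_le_rpow (enorm_integral_le_lintegral_enorm _) hq.le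
  have hint : ∀ u : ℝ → ℂ, MemLp u (ENNReal.ofReal p) (volume.restrict (Set.Ioi 0)) → ∀ k,
      IntegrableOn (fun t : ℝ => Complex.exp (lam k * t) * u t) (Set.Ioi 0) := fun u hu k => by
    refine ⟨AEStronglyMeasurable.mul ?_ hu.1, ((H u hu.1).2 hu.2.ne k).lt_top⟩
    exact (by fun_prop : Continuous fun t : ℝ => Complex.exp (lam k * t)).aestronglyMeasurable
  -- The added 1 is there because m₀ must be positive while K may vanish.
  refine ⟨K.toReal + 1, by positivity, fun u hu =>
    ⟨fun τ hτ => intervalIntegrable_semigroup B hp1.le hu hτ, ?_⟩⟩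
  obtain ⟨x, hx, hxn⟩ := key u hu
  refine ⟨x, ?_, hxn.trans (by gcongr; linarith)⟩
  have hv : ∀ τ : ℝ, MemLp ((Set.Ioi τ).indicator u) (ENNReal.ofReal p)
      (volume.restrict (Set.Ioi 0)) := fun τ => hu.indicator measurableSet_Ioi
  choose y hy hyn using fun τ : ℝ => key _ (hv τ)
  have hdiff : ∀ τ : ℝ, 0 < τ →
      ∫ t in (0 : ℝ)..τ, semigroup lam q t.toNNReal (B (u t)) = embed lam q (x - y τ) := by
    intro τ hτ
    refine Extrap.ext fun k => ?_
    rw [intervalIntegral_semigroup_apply B hτ (intervalIntegrable_semigroup B hp1.le hu hτ),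
      embed_apply, lp.coeFn_sub, Pi.sub_apply, hx, hy, ← mul_sub]
    congr 1
    have e : ∫ t in Set.Ioi (0 : ℝ), Complex.exp (lam k * t) * (Set.Ioi τ).indicator u t =
        ∫ t in Set.Ioi τ, Complex.exp (lam k * t) * u t := by
      have e1 : (fun t : ℝ => Complex.exp (lam k * t) * (Set.Ioi τ).indicator u t) =
          (Set.Ioi τ).indicator fun t : ℝ => Complex.exp (lam k * t) * u t := by
        funext t
        by_cases ht : t ∈ Set.Ioi τ <;> simp [ht]
      rw [e1, setIntegral_indicator measurableSet_Ioi, Set.inter_eq_right.2]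
      exact Set.Ioi_subset_Ioi hτ.le
    rw [e, intervalIntegral.integral_of_le hτ.le, eq_sub_iff_add_eq,
      ← setIntegral_union (Set.Ioc_disjoint_Ioi le_rfl) measurableSet_Ioi
      ((hint u hu k).mono_set Set.Ioc_subset_Ioi_self)
      ((hint u hu k).mono_set (Set.Ioi_subset_Ioi hτ.le)), Set.Ioc_union_Ioi_eq_Ioi hτ.le]
  have hy0 : Tendsto y atTop (𝓝 0) := by
    have htail : Tendsto (fun τ : ℝ => eLpNorm ((Set.Ioi τ).indicator u) (ENNReal.ofReal p)
        (volume.restrict (Set.Ioi 0))) atTop (𝓝 0) := by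
      have e : ∀ τ : ℝ, eLpNorm ((Set.Ioi τ).indicator u) (ENNReal.ofReal p)
          (volume.restrict (Set.Ioi 0)) = (∫⁻ t in Set.Ioi (0 : ℝ),
            (Set.Ioi τ).indicator (fun t => ‖u t‖ₑ ^ p) t) ^ (1 / p) := fun τ => by
        rw [eLpNorm_eq_lintegral_rpow_enorm_toReal (by simpa using hp) ENNReal.ofReal_ne_top,
          ENNReal.toReal_ofReal hp.le]
        congr 2
        funext t
        by_cases ht : t ∈ Set.Ioi τ <;> simp [ht, hp]
      simp only [e]
      have h0 : Tendsto (fun τ : ℝ => ∫⁻ t in Set.Ioi (0 : ℝ),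
          (Set.Ioi τ).indicator (fun t => ‖u t‖ₑ ^ p) t) atTop
          (𝓝 (∫⁻ _ in Set.Ioi (0 : ℝ), 0)) := by
        refine tendsto_lintegral_filter_of_dominated_convergence' (fun t => ‖u t‖ₑ ^ p)
          (Eventually.of_forall fun τ =>
            (hu.1.enorm.pow_const p).indicator measurableSet_Ioi)
          (Eventually.of_forall fun τ => Eventually.of_forall fun t =>
            Set.indicator_le_self _ _ t) ?_ (Eventually.of_forall fun t => ?_)
        · have := lintegral_rpow_enorm_lt_top_of_eLpNorm_lt_top (by simpa using hp)
            ENNReal.ofReal_ne_top hu.2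
          rw [ENNReal.toReal_ofReal hp.le] at this
          exact this.ne
        · refine tendsto_const_nhds.congr' ?_
          filter_upwards [eventually_ge_atTop t] with τ hτ
          rw [Set.indicator_of_notMem (by simpa using hτ)]
      rw [lintegral_zero] at h0
      have := h0.ennrpow_const (1 / p)
      rwa [ENNReal.zero_rpow_of_pos (by positivity)] at this
    refine squeeze_zero_norm hyn ?_
    have := ((ENNReal.tendsto_toReal ENNReal.zero_ne_top).comp htail).const_mul K.toReal
    simpa using this
  have hlim : Tendsto (fun τ => embed lam q (x - y τ)) atTop (𝓝 (embed lam q x)) := by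
    have := ((embed lam q).continuous.tendsto (x - 0)).comp (tendsto_const_nhds.sub hy0)
    rwa [sub_zero] at this
  refine hlim.congr' ?_
  filter_upwards [eventually_gt_atTop 0] with τ hτ
  exact (hdiff τ hτ).symm

end control

/-! ### Admissibility implies the strip condition -/

/-- Re (s+z)⁻¹ = (s + Re z)/|s+z|², and in the sector |s+z| ≤ (s + Re z)/κ. This positivity excludes
cancellation among the test exponentials. -/
theorem re_inv_add_ge {κ : ℝ} (hκ : 0 < κ) {z : ℂ} (hz : κ * ‖z‖ ≤ z.re) (hz0 : 0 < z.re)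
    (hκ1 : κ ≤ 1) {s : ℝ} (hs : 0 < s) :
    κ ^ 2 / (s + z.re) ≤ (((s : ℂ) + z)⁻¹).re := by
  have h1 : ‖(s : ℂ) + z‖ ≤ (s + z.re) / κ := by
    rw [le_div_iff₀ hκ]
    have : ‖(s : ℂ) + z‖ ≤ s + ‖z‖ := by
      refine (norm_add_le _ _).trans_eq ?_
      rw [Complex.norm_real, Real.norm_of_nonneg hs.le]
    nlinarith
  have hpos : 0 < s + z.re := by positivity
  have hne : (s : ℂ) + z ≠ 0 := fun h => by
    have := congrArg Complex.re h
    simp only [Complex.add_re, Complex.ofReal_re, Complex.zero_re] at this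
    linarith
  have hn : 0 < ‖(s : ℂ) + z‖ := norm_pos_iff.2 hne
  rw [Complex.inv_re, Complex.normSq_eq_norm_sq, Complex.add_re, Complex.ofReal_re,
    div_le_div_iff₀ hpos (by positivity)]
  rw [le_div_iff₀ hκ] at h1
  have := pow_le_pow_left₀ (by positivity) h1 2
  rw [mul_pow] at this
  linarith

theorem integral_exp_mul_expKernel (α : ℝ) (n : ℤ) (l : LeftHP) :
    IntegrableOn (fun t : ℝ => Complex.exp (l * t) * (expKernel α n t : ℂ)) (Set.Ioi 0) ∧
    ∫ t in Set.Ioi (0 : ℝ), Complex.exp (l * t) * (expKernel α n t : ℂ) =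
      ((((2 : ℝ) ^ n) ^ α : ℝ) : ℂ) * ((((2 : ℝ) ^ n / 2 : ℝ) : ℂ) + -(l : ℂ))⁻¹ := by
  have hn : (0 : ℝ) < (2 : ℝ) ^ n / 2 := by positivity
  set a : ℂ := (l : ℂ) - (((2 : ℝ) ^ n / 2 : ℝ) : ℂ) with ha
  have ha0 : a.re < 0 := by
    have := l.2
    rw [ha, Complex.sub_re, Complex.ofReal_re]
    linarith
  have e : (fun t : ℝ => Complex.exp (l * t) * (expKernel α n t : ℂ)) =
      fun t : ℝ => ((((2 : ℝ) ^ n) ^ α : ℝ) : ℂ) * Complex.exp (a * t) := by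
    funext t
    rw [expKernel, Complex.ofReal_mul, Complex.ofReal_exp, mul_left_comm, ← Complex.exp_add, ha]
    congr 2
    push_cast
    ring
  rw [e, integral_const_mul, integral_exp_mul_complex_Ioi ha0]
  refine ⟨(integrableOn_exp_mul_complex_Ioi ha0 0).const_mul _, ?_⟩
  congr 1
  rw [Complex.ofReal_zero, mul_zero, Complex.exp_zero, neg_div, ← div_neg, one_div, ha]
  congr 1
  ring

section control

variable {lam : ℕ → LeftHP} {q : ℝ} [Fact (1 ≤ q)] (B : ℂ →L[ℂ] Extrap lam q)

/-- The inputs Σ_{n∈F} c_n 2^(n/p) exp(-2^n t/2) produce x_k = b_k Σ d_n (2^n/2 - λ_k)⁻¹ with d_n =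
2^(n/p) c_n. Keeping one term on each strip and summing |x_k|^q yields the inequality required by
the duality lemma. -/
theorem tsum_stripWeight_of_isAdmissible {p θ : ℝ} (hqp : q < p) (hθ₀ : 0 < θ)
    (hθ₁ : θ < Real.pi / 2) (hlam : ∀ k, -(lam k : ℂ) ∈ sector θ)
    (h : IsAdmissible lam q p B) : ∑' n, stripWeight B p n ^ (p / (p - q)) ≠ ⊤ := by
  have hq1 : 1 ≤ q := Fact.out
  have hq : 0 < q := by linarith
  have hp1 : 1 < p := by linarith
  have hp : 0 < p := by linarith
  have hpp : p.HolderConjugate p.conjExponent := Real.HolderConjugate.conjExponent hp1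
  have hinv : 1 / p = 1 - 1 / p.conjExponent := by
    have := hpp.inv_add_inv_eq_one
    rw [one_div, one_div]
    linarith
  obtain ⟨M, hM, H⟩ := exists_lintegral_expSum_le hpp
  obtain ⟨m₀, hm₀, hadm⟩ := h
  have hκ : 0 < Real.cos θ := Real.cos_pos_of_mem_Ioo ⟨by linarith, hθ₁⟩
  have hκ1 := Real.cos_le_one θ
  set κ := Real.cos θ
  set δ : ℝ := (κ ^ 2 / 2) ^ q with hδ
  have hδ0 : 0 < δ := by positivity
  refine tsum_rpow_ne_top_of_forall_finset hq hqp
    (M := (ENNReal.ofReal δ)⁻¹ * (ENNReal.ofReal m₀ ^ q * M ^ (q / p)))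
    (ENNReal.mul_ne_top (ENNReal.inv_ne_top.2 (by simpa using hδ0))
      (ENNReal.mul_ne_top (ENNReal.rpow_ne_top_of_nonneg hq.le ENNReal.ofReal_ne_top)
        (ENNReal.rpow_ne_top_of_nonneg (by positivity) hM))) fun F c => ?_
  set v : ℝ → ℝ := fun t => ∑ n ∈ F, expKernel (1 / p) n t * c n with hv
  set u : ℝ → ℂ := fun t => (v t : ℂ) with hu
  have hvm : Measurable v :=
    Finset.measurable_fun_sum _ fun n _ => (measurable_expKernel _ n).mul_const _
  set S : ℝ≥0∞ := ∑ n ∈ F, (c n : ℝ≥0∞) ^ p with hS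
  have hS_top : S ≠ ⊤ := by
    rw [hS, ENNReal.sum_ne_top]
    exact fun n _ => ENNReal.rpow_ne_top_of_nonneg hp.le ENNReal.coe_ne_top
  have hu_norm : ∀ t, ‖u t‖ₑ = ∑ n ∈ F, ENNReal.ofReal (expKernel (1 / p) n t) * c n := fun t => by
    rw [← ofReal_norm, hu, Complex.norm_real, Real.norm_of_nonneg, hv,
      ENNReal.ofReal_sum_of_nonneg]
    · refine Finset.sum_congr rfl fun n _ => ?_
      rw [ENNReal.ofReal_mul (expKernel_nonneg _ _ _), ENNReal.ofReal_coe_nnreal]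
    · exact fun n _ => mul_nonneg (expKernel_nonneg _ _ _) (c n).2
    · exact Finset.sum_nonneg fun n _ => mul_nonneg (expKernel_nonneg _ _ _) (c n).2
  have hE : eLpNorm u (ENNReal.ofReal p) (volume.restrict (Set.Ioi 0)) ≤ (M * S) ^ (1 / p) := by
    rw [eLpNorm_eq_lintegral_rpow_enorm_toReal (by simpa using hp) ENNReal.ofReal_ne_top,
      ENNReal.toReal_ofReal hp.le]
    refine ENNReal.rpow_le_rpow ?_ (by positivity)
    have := H ((F : Set ℤ).indicator fun n => (c n : ℝ≥0∞))
    have e1 : ∀ t, ∑' n, ENNReal.ofReal (expKernel (1 / p) n t) *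
        (F : Set ℤ).indicator (fun n => (c n : ℝ≥0∞)) n = ‖u t‖ₑ := fun t => by
      rw [hu_norm, tsum_eq_sum (s := F) fun n hn => by simp [hn]]
      exact Finset.sum_congr rfl fun n hn => by simp [hn]
    have e2 : ∑' n, (F : Set ℤ).indicator (fun n => (c n : ℝ≥0∞)) n ^ p = S := by
      rw [tsum_eq_sum (s := F) fun n hn => by simp [hn, hp]]
      exact Finset.sum_congr rfl fun n hn => by simp [hn]
    simp only [e1, e2] at this
    exact this
  have hE_top : (M * S) ^ (1 / p) ≠ ⊤ :=
    ENNReal.rpow_ne_top_of_nonneg (by positivity) (ENNReal.mul_ne_top hM hS_top)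
  have huL : MemLp u (ENNReal.ofReal p) (volume.restrict (Set.Ioi 0)) :=
    ⟨(Complex.measurable_ofReal.comp hvm).aestronglyMeasurable, hE.trans_lt hE_top.lt_top⟩
  obtain ⟨hint, x, hx, hxn⟩ := hadm u huL
  set d : ℤ → ℝ := fun n => ((2 : ℝ) ^ n) ^ (1 / p) * c n with hd
  have hd0 : ∀ n, 0 ≤ d n := fun n => mul_nonneg (by positivity) (c n).2
  have hxk : ∀ k, x k = B 1 k *
      ∑ n ∈ F, (d n : ℂ) * ((((2 : ℝ) ^ n / 2 : ℝ) : ℂ) + -(lam k : ℂ))⁻¹ := fun k => by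
    have hl1 : Tendsto (fun τ : ℝ => B 1 k * ∫ t in (0 : ℝ)..τ, Complex.exp (lam k * t) * u t)
        atTop (𝓝 (x k)) := by
      have := ((Extrap.coord lam q k).continuous.tendsto _).comp hx
      rw [Extrap.coord_apply, embed_apply] at this
      refine this.congr' ?_
      filter_upwards [eventually_gt_atTop 0] with τ hτ
      rw [Function.comp_apply, Extrap.coord_apply,
        intervalIntegral_semigroup_apply B hτ (hint τ hτ)]
    have e : (fun t : ℝ => Complex.exp (lam k * t) * u t) = fun t : ℝ =>
        ∑ n ∈ F, Complex.exp (lam k * t) * (expKernel (1 / p) n t : ℂ) * (c n : ℂ) := by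
      funext t
      rw [hu, hv]
      push_cast
      rw [Finset.mul_sum]
      exact Finset.sum_congr rfl fun n _ => by simp [mul_assoc]
    have hi : ∀ n ∈ F, IntegrableOn (fun t : ℝ =>
        Complex.exp (lam k * t) * (expKernel (1 / p) n t : ℂ) * (c n : ℂ)) (Set.Ioi 0) :=
      fun n _ => (integral_exp_mul_expKernel (1 / p) n (lam k)).1.mul_const _
    have hl2 := intervalIntegral_tendsto_integral_Ioi (0 : ℝ)
      (integrable_finsetSum F hi) tendsto_id
    rw [integral_finsetSum F hi, ← e] at hl2
    refine (tendsto_nhds_unique hl1 (hl2.const_mul (B 1 k))).trans ?_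
    congr 1
    refine Finset.sum_congr rfl fun n _ => ?_
    rw [integral_mul_const, (integral_exp_mul_expKernel (1 / p) n (lam k)).2, hd]
    push_cast
    ring
  have hlow : ∀ k n, -(lam k : ℂ) ∈ strip n → n ∈ F →
      κ ^ 2 / 2 * ((2 : ℝ) ^ n) ^ (-(1 / p.conjExponent)) * c n ≤
      ‖∑ n ∈ F, (d n : ℂ) * ((((2 : ℝ) ^ n / 2 : ℝ) : ℂ) + -(lam k : ℂ))⁻¹‖ := by
    intro k n hk hn
    have hz0 := re_neg_pos (lam k)
    have hre : ∀ j : ℤ, κ ^ 2 / ((2 : ℝ) ^ j / 2 + (-(lam k : ℂ)).re) ≤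
        (((((2 : ℝ) ^ j / 2 : ℝ) : ℂ) + -(lam k : ℂ))⁻¹).re := fun j =>
      re_inv_add_ge hκ (cos_mul_norm_le_re hθ₁ (hlam k)) hz0 hκ1 (by positivity)
    refine le_trans ?_ (Complex.re_le_norm _)
    rw [Complex.re_sum]
    simp only [Complex.re_ofReal_mul]
    -- All real parts are nonnegative, so every term but the n-th may be dropped.
    refine le_trans ?_ (Finset.single_le_sum (f := fun j : ℤ => d j *
      (((((2 : ℝ) ^ j / 2 : ℝ) : ℂ) + -(lam k : ℂ))⁻¹).re) (fun j _ => mul_nonneg (hd0 j)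
        (le_trans (by positivity) (hre j))) hn)
    have hn0 : (0 : ℝ) < (2 : ℝ) ^ n := by positivity
    -- On strip n, 2^n/2 + Re(-λ_k) ≤ (3/2) 2^n ≤ 2 · 2^n, the origin of κ²/2 in δ.
    have h1 : κ ^ 2 / 2 / 2 ^ n ≤ (((((2 : ℝ) ^ n / 2 : ℝ) : ℂ) + -(lam k : ℂ))⁻¹).re := by
      refine le_trans ?_ (hre n)
      rw [div_div]
      have := hk.2
      gcongr
      linarith
    refine le_trans (le_of_eq ?_) (mul_le_mul_of_nonneg_left h1 (hd0 n))
    simp only [hd]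
    rw [hinv, sub_eq_add_neg, Real.rpow_add hn0, Real.rpow_one]
    field_simp
  have hmain : ∑' n, controlMeasure lam q B (strip n) * (F : Set ℤ).indicator (fun n =>
      ENNReal.ofReal ((κ ^ 2 / 2 * ((2 : ℝ) ^ n) ^ (-(1 / p.conjExponent)) * c n) ^ q)) n ≤
      ENNReal.ofReal ‖x‖ ^ q := by
    rw [ofReal_norm_rpow]
    refine (tsum_strip_le_tsum B (F := fun k => ENNReal.ofReal
      (‖∑ n ∈ F, (d n : ℂ) * ((((2 : ℝ) ^ n / 2 : ℝ) : ℂ) + -(lam k : ℂ))⁻¹‖ ^ q))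
      fun k n hk => ?_).trans_eq ?_
    · by_cases hn : n ∈ F
      · rw [Set.indicator_of_mem (by simpa using hn)]
        refine ENNReal.ofReal_le_ofReal (Real.rpow_le_rpow ?_ (hlow k n hk hn) hq.le)
        positivity
      · rw [Set.indicator_of_notMem (by simpa using hn)]
        simp
    · refine tsum_congr fun k => ?_
      rw [hxk, norm_mul, Real.mul_rpow (norm_nonneg _) (norm_nonneg _),
        ENNReal.ofReal_mul (by positivity)]
  rw [tsum_eq_sum (s := F) fun n hn => by simp [hn]] at hmain
  have e3 : ∑ n ∈ F, controlMeasure lam q B (strip n) * (F : Set ℤ).indicator (fun n =>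
      ENNReal.ofReal ((κ ^ 2 / 2 * ((2 : ℝ) ^ n) ^ (-(1 / p.conjExponent)) * c n) ^ q)) n =
      ENNReal.ofReal δ * ∑ n ∈ F, stripWeight B p n * (c n : ℝ≥0∞) ^ q := by
    rw [Finset.mul_sum]
    refine Finset.sum_congr rfl fun n hn => ?_
    have hn0 : (0 : ℝ) < (2 : ℝ) ^ n := by positivity
    rw [Set.indicator_of_mem (by simpa using hn), Real.mul_rpow (by positivity) (c n).coe_nonneg,
      Real.mul_rpow (by positivity) (by positivity), ← Real.rpow_mul hn0.le,
      ENNReal.ofReal_mul (by positivity), ENNReal.ofReal_mul (by positivity), stripWeight,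
      ← ENNReal.ofReal_rpow_of_nonneg (c n).coe_nonneg hq.le, ENNReal.ofReal_coe_nnreal,
      show -(1 / p.conjExponent) * q = -(q / p.conjExponent) by ring]
    ring
  rw [e3] at hmain
  have hx_le : ENNReal.ofReal ‖x‖ ≤ ENNReal.ofReal m₀ * (M * S) ^ (1 / p) := by
    refine (ENNReal.ofReal_le_ofReal hxn).trans ?_
    rw [ENNReal.ofReal_mul hm₀.le, ENNReal.ofReal_toReal huL.2.ne]
    gcongr
  have hδ_ne : ENNReal.ofReal δ ≠ 0 := by simpa using hδ0
  have hfin := hmain.trans (ENNReal.rpow_le_rpow hx_le hq.le)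
  rw [mul_comm, ← ENNReal.le_div_iff_mul_le (Or.inl hδ_ne) (Or.inl ENNReal.ofReal_ne_top),
    ENNReal.div_eq_inv_mul] at hfin
  refine hfin.trans_eq ?_
  rw [ENNReal.mul_rpow_of_nonneg _ _ hq.le, ← ENNReal.rpow_mul,
    ENNReal.mul_rpow_of_nonneg _ _ (by positivity), show 1 / p * q = q / p by ring]
  ring

theorem isAdmissible_iff_tsum_stripWeight {p θ : ℝ} (hqp : q < p) (hθ₀ : 0 < θ)
    (hθ₁ : θ < Real.pi / 2) (hlam : ∀ k, -(lam k : ℂ) ∈ sector θ) :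
    IsAdmissible lam q p B ↔ ∑' n, stripWeight B p n ^ (p / (p - q)) ≠ ⊤ :=
  ⟨tsum_stripWeight_of_isAdmissible B hqp hθ₀ hθ₁ hlam, isAdmissible_of_tsum_stripWeight B hqp⟩

end control

end DiagSystem

end

theorem mainTheorem7 (p q θ : ℝ) [Fact (1 ≤ q)] (hqp : q < p)
    (hθ₀ : 0 < θ) (hθ₁ : θ < Real.pi / 2)
    (lam : ℕ → DiagSystem.LeftHP) (hlam : ∀ k, -(lam k : ℂ) ∈ DiagSystem.sector θ)
    (B : ℂ →L[ℂ] DiagSystem.Extrap lam q) :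
    List.TFAE [
      DiagSystem.IsAdmissible lam q p B,
      (∀ n : ℤ, DiagSystem.controlMeasure lam q B (DiagSystem.strip n) < ∞) ∧
        Memℓp (fun n : ℤ => (2 : ℝ) ^ (-(n : ℝ) * q / p.conjExponent) *
            (DiagSystem.controlMeasure lam q B).real (DiagSystem.strip n))
          (ENNReal.ofReal (p / (p - q))),
      Memℓp (fun n : ℤ => (2 : ℝ) ^ ((n : ℝ) / p) *
          ‖(DiagSystem.resolvent lam q ((2 : ℝ) ^ n) (zpow_pos two_pos n)).comp B‖)
        (ENNReal.ofReal (q * p / (p - q)))] ∧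
    (q < p.conjExponent →
      (DiagSystem.IsAdmissible lam q p B ↔
        MemLp (fun t : ℝ => ENNReal.ofReal (|t| ^ (q * (2 - p) / p)) *
            DiagSystem.balayage (DiagSystem.controlMeasure lam q B) t)
          (ENNReal.ofReal (p / (p - q))) volume)) := by
  have hq : 0 < q := lt_of_lt_of_le one_pos Fact.out
  have h₁ := DiagSystem.isAdmissible_iff_tsum_stripWeight B hqp hθ₀ hθ₁ hlam
  have h₂ := DiagSystem.stripWeight_memlp_iff B hq hqp
  have h₃ := DiagSystem.resolvent_memlp_iff B hqp hθ₀ hθ₁ hlam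
  refine ⟨?_, fun hqp' => h₁.trans
    (DiagSystem.balayage_memLp_iff B hqp hθ₀ hθ₁ hlam hqp').symm⟩
  tfae_have 1 ↔ 2 := h₁.trans h₂.symm
  tfae_have 1 ↔ 3 := h₁.trans h₃.symm
  tfae_finish
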